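/- Let $n\ge 2$. On $L^2(\mathbb R^n)$ let $\hat x_j f(x)=x_jf(x)$ and $\hat p_j f=-{\rm i}\,\partial_{x_j} f$ ($1\le j\le n$) be the position and momentum operators of $n$ quantum harmonic oscillators, and define the Jordan–Schwinger operators $$\hat H_i=\tfrac12\left(\hat x_i^2+\hat p_i^2-\hat x_{i+1}^2-\hat p_{i+1}^2\right),\qquad \hat S_{j,k}=\tfrac12\left(\hat x_j\hat x_k+\hat p_j\hat p_k\right),\qquad \hat A_{j,k}=\tfrac12\left(\hat p_j\hat x_k-\hat x_j\hat p_k\right),$$ for $1\le i\le n-1$ and $1\le j<k\le n$. These operators, as well as the operators $\hat x_j^2$, $\hat p_j^2$ ($1\le j\le n$) and $\hat x_j\hat x_k$, $\hat p_j\hat p_k$, $\hat x_j\hat p_k$, $\hat p_j\hat x_k$ ($1\le j<k\le n$), are defined on the Schwartz functions; the closure of each of them generates a unique strongly continuous one-parameter unitary group on $L^2(\mathbb R^n)$, and $e^{{\rm i}t\hat O}$ denotes the element at time $t\in\mathbb R$ of the group generated by (the closure of) $\hat O$. Let $\varsigma,\vartheta,\varphi\in[-\pi/2,\pi/2]$.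 Then for all $1\le i\le n-1$ and $1\le j<k\le n$, as equalities of unitary operators on $L^2(\mathbb R^n)$, $$e^{{\rm i}\varsigma\hat H_i}=e^{{\rm i}\varsigma_1\hat p_i^2}\,e^{{\rm i}\varsigma_2\hat x_i^2}\,e^{{\rm i}\varsigma_1\hat p_i^2}\,e^{-{\rm i}\varsigma_1\hat p_{i+1}^2}\,e^{-{\rm i}\varsigma_2\hat x_{i+1}^2}\,e^{-{\rm i}\varsigma_1\hat p_{i+1}^2},$$ $$e^{{\rm i}\vartheta\hat S_{j,k}}=e^{{\rm i}\vartheta_1\hat p_j\hat p_k}\,e^{{\rm i}\vartheta_2\hat x_j\hat x_k}\,e^{{\rm i}\vartheta_1\hat p_j\hat p_k},$$ $$e^{{\rm i}\varphi\hat A_{j,k}}=e^{-{\rm i}\varphi_1\hat x_j\hat p_k}\,e^{{\rm i}\varphi_2\hat p_j\hat x_k}\,e^{-{\rm i}\varphi_1\hat x_j\hat p_k},$$ where $\varsigma_1=\tfrac12\tan(\varsigma/2)$, $\varsigma_2=\tfrac12\sin\varsigma$, $\vartheta_1=\tan(\vartheta/4)$, $\vartheta_2=\sin(\vartheta/2)$,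 $\varphi_1=\tan(\varphi/4)$ and $\varphi_2=\sin(\varphi/2)$. -/

import Mathlib

open MeasureTheory
open scoped SchwartzMap LineDeriv

namespace Oscillator

noncomputable section

/-- The configuration space `ℝⁿ` of `n` one-dimensional oscillators. -/
abbrev Config (n : ℕ) : Type := EuclideanSpace ℝ (Fin n)

/-- Complex-valued Schwartz functions on `ℝⁿ`: the common invariant domain on which the position
and momentum operators and their polynomials are defined. -/
abbrev Schw (n : ℕ) : Type := 𝓢(Config n, ℂ)

/-- The Hilbert space `L²(ℝⁿ; ℂ)` of `n` quantum harmonic oscillators. -/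
abbrev Hilb (n : ℕ) : Type := Lp ℂ 2 (volume : Measure (Config n))

variable {n : ℕ}

/-- Position operator of mode `j` : `(x̂ⱼ f)(x) = xⱼ f(x)`. -/
def posOp (j : Fin n) : Schw n →L[ℂ] Schw n :=
  SchwartzMap.smulLeftCLM ℂ (fun x : Config n => ((x j : ℝ) : ℂ))

/-- Momentum operator of mode `j` : `p̂ⱼ f = -i ∂ⱼ f`. -/
def momOp (j : Fin n) : Schw n →L[ℂ] Schw n :=
  (-Complex.I) • LineDeriv.lineDerivOpCLM ℂ (Schw n) (EuclideanSpace.single j (1 : ℝ))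

theorem posOp_apply (j : Fin n) (f : Schw n) (x : Config n) :
    posOp j f x = ((x j : ℝ) : ℂ) * f x := by
  have h : Function.HasTemperateGrowth (fun x : Config n => ((x j : ℝ) : ℂ)) :=
    (Complex.ofRealCLM.comp (EuclideanSpace.proj j : Config n →L[ℝ] ℝ)).hasTemperateGrowth
  simp [posOp, SchwartzMap.smulLeftCLM_apply_apply h]

theorem momOp_apply (j : Fin n) (f : Schw n) (x : Config n) :
    momOp j f x = -Complex.I * lineDeriv ℝ (fun y => f y) x (EuclideanSpace.single j (1 : ℝ)) := by
  simp [momOp, SchwartzMap.lineDerivOp_apply]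

/-- `Ĥ = ½ (x̂ᵢ² + p̂ᵢ² - x̂ᵢ₊₁² - p̂ᵢ₊₁²)`, for the two modes `i` and `i' = i + 1`. -/
def opH (i i' : Fin n) : Schw n →L[ℂ] Schw n :=
  (1 / 2 : ℂ) • (posOp i ∘L posOp i + momOp i ∘L momOp i
    - posOp i' ∘L posOp i' - momOp i' ∘L momOp i')

/-- `Ŝⱼₖ = ½ (x̂ⱼ x̂ₖ + p̂ⱼ p̂ₖ)`. -/
def opS (j k : Fin n) : Schw n →L[ℂ] Schw n :=
  (1 / 2 : ℂ) • (posOp j ∘L posOp k + momOp j ∘L momOp k)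

/-- `Âⱼₖ = ½ (p̂ⱼ x̂ₖ - x̂ⱼ p̂ₖ)`. -/
def opA (j k : Fin n) : Schw n →L[ℂ] Schw n :=
  (1 / 2 : ℂ) • (momOp j ∘L posOp k - posOp j ∘L momOp k)

/-- The graph in `L²(ℝⁿ) × L²(ℝⁿ)` of the operator `T` with domain the Schwartz functions. -/
def schwartzGraph (T : Schw n →L[ℂ] Schw n) : Submodule ℂ (Hilb n × Hilb n) :=
  LinearMap.range
    ((SchwartzMap.toLpCLM ℂ ℂ 2 (volume : Measure (Config n))).toLinearMap.prod
      ((SchwartzMap.toLpCLM ℂ ℂ 2 (volume : Measure (Config n))).toLinearMap ∘ₗ T.toLinearMap))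

/-- `U` is the strongly continuous one-parameter unitary group `t ↦ e^{i t T̄}`, where `T̄` is the
closure in `L²(ℝⁿ)` of the operator `T` on Schwartz functions: `f` lies in the domain of `T̄` and
`T̄ f = g` exactly when `t ↦ U t f` has derivative `i g` at `t = 0`. -/
structure IsExpGroup (T : Schw n →L[ℂ] Schw n) (U : ℝ → Hilb n →L[ℂ] Hilb n) : Prop where
  map_zero : U 0 = ContinuousLinearMap.id ℂ (Hilb n)
  map_add : ∀ s t : ℝ, U (s + t) = U s ∘L U t
  norm_map : ∀ (t : ℝ) (f : Hilb n), ‖U t f‖ = ‖f‖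
  continuous : ∀ f : Hilb n, Continuous fun t => U t f
  generator : ∀ f g : Hilb n, HasDerivAt (fun t => U t f) (Complex.I • g) 0 ↔
    (f, g) ∈ (schwartzGraph T).topologicalClosure

/-- The exponentials `e^{i t T}`, `t : ℝ`, are well defined: there is exactly one strongly
continuous unitary group generated by the closure of `T`. (By Stone's theorem this says that `T`
is essentially self-adjoint on the Schwartz functions.) -/
def HasExp (T : Schw n →L[ℂ] Schw n) : Prop := ∃! U : ℝ → Hilb n →L[ℂ] Hilb n, IsExpGroup T U

open Classical in
/-- `expI t T` is the unitary `e^{i t T}` on `L²(ℝⁿ)` (with the value `0` if not `HasExp T`). -/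
def expI (t : ℝ) (T : Schw n →L[ℂ] Schw n) : Hilb n →L[ℂ] Hilb n :=
  if h : HasExp T then h.choose t else 0

end

end Oscillator

/-! Each factorization is an identity in a copy of `SL₂`. The three summands or factors involved are
a pair of quadratic operators `E`, `F` (up to a factor `1/2`, their sum is the generator) and a
bracket `K`. Conjugation by `exp(iαF)` and `exp(iβE)` acts on the span of `E`, `K`, `F` by unipotent
matrices. Differentiating `A(α) B(β) A(α)` in time and moving all generators to the left gives a
combination of `E`, `K`, `F`. With `α = tan(rt/4)/r` and `β = sin(rt/2)/r` it equals `(E + F)/2`, so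
the product solves the evolution equation for as long as the tangent has no pole
(`isLocalFlow_three_factor`).

The analytic difficulty is that the operators are unbounded. All computations take place on Schwartz
functions, which the explicit factors (phases, Fourier multipliers, shears) preserve. A symmetric
generator conserves the norm, so solutions are unique and local solutions extend to a one-parameter
group (`IsLocalFlow.exists_isFlow`). Such a group extends by density to unitaries on `L²`.
Invariance of the domain forces the range of `T + i` to be dense, so the generator is exactly the
closure of `T` (`IsFlow.generator_iff`). This yields both existence of the exponentials and their
formulas on a dense subspace.

For `opS` the pair is `xⱼxₖ`, `pⱼpₖ`; for `opA` it is `pⱼxₖ`, `-xⱼpₖ`. For `opH`, the difference of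
squares `x² - y² = (x - y)(x + y)` reduces it to the first case along the orthogonal vectors `e -
e'`, `e + e'`, of squared length `2`; the resulting factors then split between the two modes. -/

namespace Oscillator

/-! ### Symmetric linear relations: conservation of norm and uniqueness of groups. -/

section SymmetricGraph

variable {H : Type*} [NormedAddCommGroup H] [InnerProductSpace ℂ H]

/-- A linear relation on a Hilbert space is symmetric if `⟪T f, g⟫ = ⟪f, T g⟫` on it. -/
def SymmGraph (G : Submodule ℂ (H × H)) : Prop :=
  ∀ p ∈ G, ∀ q ∈ G, inner ℂ p.2 q.1 = inner ℂ p.1 q.2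

/-- The symmetry identity is a closed condition on pairs of points of the graph. -/
theorem SymmGraph.topologicalClosure {G : Submodule ℂ (H × H)} (hG : SymmGraph G) :
    SymmGraph G.topologicalClosure := by
  intro p hp q hq
  have hmem : (p, q) ∈ closure ((G : Set (H × H)) ×ˢ (G : Set (H × H))) := by
    rw [closure_prod_eq]
    exact ⟨hp, hq⟩
  have hclosed : IsClosed {r : (H × H) × (H × H) | inner ℂ r.1.2 r.2.1 = inner ℂ r.1.1 r.2.2} :=
    isClosed_eq (by fun_prop) (by fun_prop)
  exact closure_minimal (fun r hr => hG r.1 hr.1 r.2 hr.2) hclosed hmem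

variable [NormedSpace ℝ H]

/-- Trajectories of a symmetric operator have constant norm. -/
theorem SymmGraph.norm_eq {G : Submodule ℂ (H × H)} (hG : SymmGraph G) {y g : ℝ → H} {s : Set ℝ}
    (hs : IsOpen s) (hc : IsPreconnected s)
    (hy : ∀ t ∈ s, HasDerivAt y (Complex.I • g t) t) (hm : ∀ t ∈ s, (y t, g t) ∈ G)
    {a b : ℝ} (ha : a ∈ s) (hb : b ∈ s) : ‖y a‖ = ‖y b‖ := by
  have hd : ∀ t ∈ s, HasDerivAt (fun t => inner ℂ (y t) (y t)) 0 t := by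
    intro t ht
    have h := (hy t ht).inner ℂ (hy t ht)
    have h2 := hG _ (hm t ht) _ (hm t ht)
    have h3 : inner ℂ (y t) (Complex.I • g t) + inner ℂ (Complex.I • g t) (y t) = 0 := by
      rw [inner_smul_left, inner_smul_right]
      simp only at h2
      rw [h2]
      simp
    rwa [h3] at h
  have h := hs.is_const_of_deriv_eq_zero hc
    (fun t ht => (hd t ht).differentiableAt.differentiableWithinAt)
    (fun t ht => (hd t ht).deriv) ha hb
  have h1 := inner_self_eq_norm_sq_to_K (𝕜 := ℂ) (y a)
  have h2 := inner_self_eq_norm_sq_to_K (𝕜 := ℂ) (y b)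
  rw [h, h2] at h1
  have h4 : ‖y b‖ ^ 2 = ‖y a‖ ^ 2 := by exact_mod_cast h1
  exact ((sq_eq_sq₀ (norm_nonneg _) (norm_nonneg _)).1 h4).symm

/-- A one-parameter group of operators is determined by its generator, if that is symmetric and
densely defined. -/
theorem SymmGraph.group_unique {G : Submodule ℂ (H × H)} (hG : SymmGraph G)
    (hdense : Dense {f : H | ∃ g, (f, g) ∈ G}) {U V : ℝ → H →L[ℂ] H}
    (hU0 : U 0 = ContinuousLinearMap.id ℂ H) (hV0 : V 0 = ContinuousLinearMap.id ℂ H)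
    (hU : ∀ s t, U (s + t) = U s ∘L U t) (hV : ∀ s t, V (s + t) = V s ∘L V t)
    (hUg : ∀ f g, HasDerivAt (fun t => U t f) (Complex.I • g) 0 ↔ (f, g) ∈ G)
    (hVg : ∀ f g, HasDerivAt (fun t => V t f) (Complex.I • g) 0 ↔ (f, g) ∈ G) : U = V := by
  -- A group preserves the graph of its generator and commutes with it, so the difference of two
  -- orbits of `f` is again a trajectory in `G`. It starts at `0` and has constant norm.
  have key : ∀ {W : ℝ → H →L[ℂ] H}, (∀ s t, W (s + t) = W s ∘L W t) →
      (∀ f g, HasDerivAt (fun t => W t f) (Complex.I • g) 0 ↔ (f, g) ∈ G) →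
      ∀ f g, (f, g) ∈ G → ∀ t, HasDerivAt (fun t => W t f) (Complex.I • W t g) t ∧
        (W t f, W t g) ∈ G := by
    intro W hW hWg f g hfg t
    have h0 := (hWg f g).2 hfg
    have h1 : HasDerivAt (fun s => W t (W s f)) (Complex.I • W t g) 0 := by
      have := ((W t).restrictScalars ℝ).hasFDerivAt.comp_hasDerivAt 0 h0
      simpa [Function.comp_def] using this
    constructor
    · have h2 : HasDerivAt (fun s => W t (W s f)) (Complex.I • W t g) (t - t) := by simpa using h1
      have h3 := h2.comp_sub_const t t
      refine h3.congr_of_eventuallyEq (Filter.Eventually.of_forall fun s => ?_)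
      have := hW t (s - t)
      simp only [add_sub_cancel] at this
      simp [this]
    · rw [← hWg]
      refine h1.congr_of_eventuallyEq (Filter.Eventually.of_forall fun s => ?_)
      change W s (W t f) = W t (W s f)
      rw [← ContinuousLinearMap.comp_apply, ← ContinuousLinearMap.comp_apply, ← hW, ← hW, add_comm]
  funext t
  have hdr : DenseRange (Subtype.val : {f : H | ∃ g, (f, g) ∈ G} → H) := by
    simpa [DenseRange] using hdense
  have heq : ⇑(U t) = ⇑(V t) := by
    refine hdr.equalizer (U t).continuous (V t).continuous ?_
    funext ⟨f, g, hfg⟩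
    have hnorm := hG.norm_eq (y := fun t => U t f - V t f) (g := fun t => U t g - V t g)
      isOpen_univ isPreconnected_univ
      (fun t _ => by
        have := (key hU hUg f g hfg t).1.sub (key hV hVg f g hfg t).1
        rwa [← smul_sub] at this)
      (fun t _ => G.sub_mem (key hU hUg f g hfg t).2 (key hV hVg f g hfg t).2)
      (Set.mem_univ t) (Set.mem_univ 0)
    simp only [hU0, hV0, sub_self, norm_zero, norm_eq_zero] at hnorm
    exact sub_eq_zero.1 hnorm
  exact ContinuousLinearMap.ext fun f => congrFun heq f

end SymmetricGraph

/-! ### Flows on an invariant dense domain. -/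

section Flow

variable {D H : Type*} [AddCommGroup D] [Module ℂ D] [NormedAddCommGroup H] [InnerProductSpace ℂ H]

/-- `T` is symmetric on the domain `D`, embedded in a Hilbert space by `ι`. -/
def SymmOn (ι : D →ₗ[ℂ] H) (T : Module.End ℂ D) : Prop :=
  ∀ f g, inner ℂ (ι (T f)) (ι g) = inner ℂ (ι f) (ι (T g))

/-- The graph of an operator with domain `D`. -/
def domGraph (ι : D →ₗ[ℂ] H) (T : Module.End ℂ D) : Submodule ℂ (H × H) :=
  LinearMap.range (ι.prod (ι ∘ₗ T))

theorem mem_domGraph (ι : D →ₗ[ℂ] H) (T : Module.End ℂ D) (f : D) :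
    (ι f, ι (T f)) ∈ domGraph ι T := ⟨f, rfl⟩

theorem SymmOn.symmGraph {ι : D →ₗ[ℂ] H} {T : Module.End ℂ D} (hT : SymmOn ι T) :
    SymmGraph (domGraph ι T) := by
  rintro _ ⟨f, rfl⟩ _ ⟨g, rfl⟩
  exact hT f g

theorem SymmOn.add {ι : D →ₗ[ℂ] H} {S T : Module.End ℂ D} (hS : SymmOn ι S) (hT : SymmOn ι T) :
    SymmOn ι (S + T) := by
  intro f g
  rw [LinearMap.add_apply, LinearMap.add_apply, map_add, map_add, inner_add_left, inner_add_right,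
    hS f g, hT f g]

theorem SymmOn.smul {ι : D →ₗ[ℂ] H} {T : Module.End ℂ D} (hT : SymmOn ι T) (c : ℝ) :
    SymmOn ι ((c : ℂ) • T) := by
  intro f g
  rw [LinearMap.smul_apply, LinearMap.smul_apply, map_smul, map_smul, inner_smul_left,
    inner_smul_right, hT f g, Complex.conj_ofReal]

theorem SymmOn.neg {ι : D →ₗ[ℂ] H} {T : Module.End ℂ D} (hT : SymmOn ι T) : SymmOn ι (-T) := by
  simpa using hT.smul (-1)

theorem SymmOn.mul {ι : D →ₗ[ℂ] H} {S T : Module.End ℂ D} (hS : SymmOn ι S) (hT : SymmOn ι T)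
    (h : S * T = T * S) : SymmOn ι (S * T) := by
  intro f g
  rw [Module.End.mul_apply, hS, hT, ← Module.End.mul_apply, h]

variable [NormedSpace ℝ H]

/-- The family `W t`, `|t| < a`, of operators on `D` solves `d/dt W t f = i T (W t f)`. -/
structure IsLocalFlow (ι : D →ₗ[ℂ] H) (T : Module.End ℂ D) (a : ℝ) (W : ℝ → Module.End ℂ D) :
    Prop where
  map_zero : W 0 = 1
  hasDerivAt : ∀ t ∈ Set.Ioo (-a) a, ∀ f,
    HasDerivAt (fun s => ι (W s f)) (Complex.I • ι (T (W t f))) t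

/-- `u` is a one-parameter group on `D` that is differentiable at `0` in the Hilbert space with
derivative `i T`. -/
structure IsFlow (ι : D →ₗ[ℂ] H) (T : Module.End ℂ D) (u : ℝ → Module.End ℂ D) : Prop where
  map_zero : u 0 = 1
  map_add : ∀ s t, u (s + t) = u s * u t
  hasDerivAt_zero : ∀ f, HasDerivAt (fun t => ι (u t f)) (Complex.I • ι (T f)) 0

variable {ι : D →ₗ[ℂ] H} {T : Module.End ℂ D} {u : ℝ → Module.End ℂ D}

theorem IsFlow.hasDerivAt (hu : IsFlow ι T u) (t : ℝ) (f : D) :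
    HasDerivAt (fun s => ι (u s f)) (Complex.I • ι (T (u t f))) t := by
  have h := hu.hasDerivAt_zero (u t f)
  rw [← sub_self t] at h
  refine (h.comp_sub_const t t).congr_of_eventuallyEq (Filter.Eventually.of_forall fun s => ?_)
  have := hu.map_add (s - t) t
  rw [sub_add_cancel] at this
  simp [this]

theorem IsFlow.isLocalFlow (hu : IsFlow ι T u) (a : ℝ) : IsLocalFlow ι T a u :=
  ⟨hu.map_zero, fun t _ f => hu.hasDerivAt t f⟩

/-- The difference of two solutions is a solution, and its norm is constant. This is the uniqueness
principle behind every identification of flows below. -/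
theorem SymmOn.trajectory_eq (hT : SymmOn ι T) (hι : Function.Injective ι) {y z : ℝ → D}
    {s : Set ℝ} (hs : IsOpen s) (hc : IsPreconnected s)
    (hy : ∀ t ∈ s, HasDerivAt (fun t => ι (y t)) (Complex.I • ι (T (y t))) t)
    (hz : ∀ t ∈ s, HasDerivAt (fun t => ι (z t)) (Complex.I • ι (T (z t))) t)
    {a b : ℝ} (ha : a ∈ s) (hb : b ∈ s) (hyz : y a = z a) : y b = z b := by
  have h := hT.symmGraph.norm_eq (y := fun t => ι (y t) - ι (z t))
    (g := fun t => ι (T (y t)) - ι (T (z t))) hs hc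
    (fun t ht => by
      have := (hy t ht).sub (hz t ht)
      rwa [← smul_sub] at this)
    (fun t ht => (domGraph ι T).sub_mem (mem_domGraph ι T (y t)) (mem_domGraph ι T (z t))) ha hb
  simp only [hyz, sub_self, norm_zero] at h
  exact hι (sub_eq_zero.1 (norm_eq_zero.1 h.symm))

theorem IsLocalFlow.norm_map {a : ℝ} {W : ℝ → Module.End ℂ D} (hW : IsLocalFlow ι T a W)
    (hT : SymmOn ι T) {t : ℝ} (ht : t ∈ Set.Ioo (-a) a) (f : D) : ‖ι (W t f)‖ = ‖ι f‖ := by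
  have h0 : (0 : ℝ) ∈ Set.Ioo (-a) a := ⟨by linarith [ht.1, ht.2], by linarith [ht.1, ht.2]⟩
  have h := hT.symmGraph.norm_eq (y := fun t => ι (W t f)) (g := fun t => ι (T (W t f)))
    isOpen_Ioo isPreconnected_Ioo (fun t ht => hW.hasDerivAt t ht f)
    (fun t _ => mem_domGraph ι T (W t f)) ht h0
  simpa [hW.map_zero] using h

theorem IsFlow.norm_map (hu : IsFlow ι T u) (hT : SymmOn ι T) (t : ℝ) (f : D) :
    ‖ι (u t f)‖ = ‖ι f‖ :=
  (hu.isLocalFlow (|t| + 1)).norm_map hT (abs_lt.1 (lt_add_one _)) f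

theorem IsFlow.mul_neg (hu : IsFlow ι T u) (t : ℝ) : u t * u (-t) = 1 := by
  rw [← hu.map_add, add_neg_cancel, hu.map_zero]

theorem IsFlow.neg_mul (hu : IsFlow ι T u) (t : ℝ) : u (-t) * u t = 1 := by
  rw [← hu.map_add, neg_add_cancel, hu.map_zero]

/-- Local solutions of the evolution equation of a symmetric operator extend to a global flow. -/
theorem IsLocalFlow.exists_isFlow {a : ℝ} (ha : 0 < a) {W : ℝ → Module.End ℂ D}
    (hW : IsLocalFlow ι T a W) (hT : SymmOn ι T) (hι : Function.Injective ι) :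
    ∃ u, IsFlow ι T u := by
  -- Both sides solve the same equation in `s`; the bound `a / 3` keeps every time that occurs
  -- inside `(-a, a)`.
  have hadd : ∀ s t : ℝ, |s| < a / 3 → |t| < a / 3 → W (s + t) = W s * W t := by
    intro s t hs ht
    rw [abs_lt] at hs ht
    ext f
    have hmem : ∀ r : ℝ, r ∈ Set.Ioo (-(a / 3)) (a / 3) → r ∈ Set.Ioo (-a) a :=
      fun r hr => ⟨by linarith [hr.1], by linarith [hr.2]⟩
    refine hT.trajectory_eq hι (y := fun r => W (r + t) f) (z := fun r => W r (W t f))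
      (s := Set.Ioo (-(a / 3)) (a / 3)) isOpen_Ioo isPreconnected_Ioo ?_ ?_
      (a := 0) (b := s) ⟨by linarith, by linarith⟩ hs ?_
    · intro r hr
      exact (hW.hasDerivAt (r + t) ⟨by linarith [hr.1], by linarith [hr.2]⟩ f).comp_add_const r t
    · intro r hr
      exact hW.hasDerivAt r (hmem r hr) _
    · simp [hW.map_zero]
  have hnat : ∀ (k : ℕ) (r : ℝ), k * |r| < a / 3 → W (k * r) = W r ^ k := by
    intro k r
    induction k with
    | zero => intro _; simp [hW.map_zero]
    | succ k ih =>
      intro h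
      push_cast at h
      have hr := abs_nonneg r
      have hk : (0 : ℝ) ≤ k * |r| := by positivity
      rw [pow_succ, ← ih (by linarith), ← hadd _ _ (by rw [abs_mul, Nat.abs_cast]; linarith)
        (by linarith)]
      congr 1
      push_cast
      ring
  -- The global flow will be `W (t / N) ^ N` for large `N`. Independence of `N` follows by comparing
  -- with the common refinement `N * M`.
  have hindep : ∀ (N M : ℕ) (t : ℝ), |t| < N * (a / 3) → |t| < M * (a / 3) →
      W (t / N) ^ N = W (t / M) ^ M := by
    have aux : ∀ (N M : ℕ) (t : ℝ), 0 < M → |t| < N * (a / 3) →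
        W (t / N) ^ N = W (t / (N * M : ℕ)) ^ (N * M) := by
      intro N M t hM h
      have hM' : (0 : ℝ) < M := by exact_mod_cast hM
      have hN : (0 : ℝ) < N := by
        by_contra hN
        have : (N : ℝ) * (a / 3) ≤ 0 := mul_nonpos_of_nonpos_of_nonneg (not_lt.1 hN) (by linarith)
        linarith [abs_nonneg t]
      have he : t / N = M * (t / (N * M : ℕ)) := by
        push_cast
        field_simp
      rw [pow_mul', ← hnat M, ← he]
      rw [← Nat.abs_cast M, ← abs_mul, ← he, abs_div, Nat.abs_cast, div_lt_iff₀ hN]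
      linarith
    intro N M t hN hM
    have pos : ∀ K : ℕ, |t| < K * (a / 3) → 0 < K := by
      intro K hK
      rcases Nat.eq_zero_or_pos K with rfl | h
      · simp at hK
        linarith [abs_nonneg t]
      · exact h
    rw [aux N M t (pos M hM) hN, aux M N t (pos N hN) hM, mul_comm]
  have hex : ∀ t : ℝ, ∃ N : ℕ, |t| < N * (a / 3) := by
    intro t
    obtain ⟨N, hN⟩ := exists_nat_gt (|t| / (a / 3))
    exact ⟨N, by rwa [div_lt_iff₀ (by linarith)] at hN⟩
  choose n hn using hex
  refine ⟨fun t => W (t / n t) ^ n t, ?_, ?_, ?_⟩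
  · simp [hW.map_zero]
  · intro s t
    obtain ⟨K, hK⟩ : ∃ K : ℕ, |s| + |t| < K * (a / 3) := by
      obtain ⟨N, hN⟩ := exists_nat_gt ((|s| + |t|) / (a / 3))
      exact ⟨N, by rwa [div_lt_iff₀ (by linarith)] at hN⟩
    have hs : |s| < K * (a / 3) := by linarith [abs_nonneg t]
    have ht : |t| < K * (a / 3) := by linarith [abs_nonneg s]
    have hst : |s + t| < K * (a / 3) := (abs_add_le s t).trans_lt hK
    have hKpos : (0 : ℝ) < K := by
      by_contra h
      have : (K : ℝ) * (a / 3) ≤ 0 := mul_nonpos_of_nonpos_of_nonneg (not_lt.1 h) (by linarith)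
      linarith [abs_nonneg t, abs_nonneg s]
    have small : ∀ r : ℝ, |r| < K * (a / 3) → |r / K| < a / 3 := by
      intro r hr
      rw [abs_div, Nat.abs_cast, div_lt_iff₀ hKpos]
      linarith
    rw [hindep _ K _ (hn s) hs, hindep _ K _ (hn t) ht, hindep _ K _ (hn (s + t)) hst, add_div,
      hadd _ _ (small s hs) (small t ht)]
    refine Commute.mul_pow ?_ K
    rw [Commute, SemiconjBy, ← hadd _ _ (small s hs) (small t ht),
      ← hadd _ _ (small t ht) (small s hs), add_comm]
  · intro f
    have h := hW.hasDerivAt 0 ⟨by linarith, by linarith⟩ f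
    rw [hW.map_zero, Module.End.one_apply] at h
    refine h.congr_of_eventuallyEq ?_
    filter_upwards [Metric.ball_mem_nhds (0 : ℝ) (show 0 < a / 3 by linarith)] with t ht
    have ht' : |t| < (1 : ℕ) * (a / 3) := by simpa using ht
    rw [hindep _ 1 t (hn t) ht']
    simp

variable [IsScalarTower ℝ ℂ H]

theorem real_smul_eq (r : ℝ) (x : H) : r • x = (r : ℂ) • x := (algebraMap_smul ℂ r x).symm

/-- `V` acts on `D` only, so the derivative is required to lie in `D`; then the first-order
remainder also lies there, and `V` preserves its norm. -/
theorem hasDerivAt_map_isometry {V : Module.End ℂ D} (hV : ∀ f, ‖ι (V f)‖ = ‖ι f‖) {y : ℝ → D}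
    {d : D} {t : ℝ} (hy : HasDerivAt (fun s => ι (y s)) (ι d) t) :
    HasDerivAt (fun s => ι (V (y s))) (ι (V d)) t := by
  rw [hasDerivAt_iff_isLittleO, ← Asymptotics.isLittleO_norm_left] at hy ⊢
  refine hy.congr_left fun s => ?_
  have h := hV (y s - y t - ((s - t : ℝ) : ℂ) • d)
  simp only [map_sub, map_smul, real_smul_eq] at h ⊢
  exact h.symm

/-- The flows of a symmetric operator and of a conjugate of it are conjugate. -/
theorem IsFlow.conj (hu : IsFlow ι T u) {V V' T' : Module.End ℂ D} (hVV' : V * V' = 1)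
    (hV'V : V' * V = 1) (hV : ∀ f, ‖ι (V f)‖ = ‖ι f‖) (hT' : V * T = T' * V) :
    IsFlow ι T' (fun t => V * u t * V') where
  map_zero := by simp [hu.map_zero, hVV']
  map_add s t := by
    rw [hu.map_add]
    calc V * (u s * u t) * V' = V * u s * 1 * u t * V' := by simp only [mul_assoc, one_mul]
      _ = _ := by rw [← hV'V]; simp only [mul_assoc]
  hasDerivAt_zero f := by
    have h := hu.hasDerivAt_zero (V' f)
    have hT2 : T' f = V (T (V' f)) := by
      have := congrArg (fun S => (S * V') f) hT'
      simp only [mul_assoc, hVV', mul_one] at this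
      exact this.symm
    rw [← map_smul] at h
    have h2 := hasDerivAt_map_isometry hV h
    rwa [map_smul, map_smul, ← hT2] at h2

/-- The product rule for `t ↦ u (α t) (y t)`. -/
theorem IsFlow.hasDerivAt_comp (hu : IsFlow ι T u) (hT : SymmOn ι T) {α : ℝ → ℝ} {α' t : ℝ}
    (hα : HasDerivAt α α' t) {y : ℝ → D} {d : D} (hy : HasDerivAt (fun s => ι (y s)) (ι d) t) :
    HasDerivAt (fun s => ι (u (α s) (y s)))
      (ι ((α' * Complex.I) • T (u (α t) (y t)) + u (α t) d)) t := by
  have h1 : HasDerivAt (fun s => ι (u (α s) (y t))) (ι ((α' * Complex.I) • T (u (α t) (y t)))) t := by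
    have := (hu.hasDerivAt (α t) (y t)).scomp t hα
    rw [real_smul_eq, smul_smul, ← map_smul] at this
    exact this
  -- `u (α s)` is isometric, so it carries the first-order remainder of `y` to one of the same size,
  -- uniformly in `s`.
  have h2 : HasDerivAt (fun s => ι (u (α s) (y s)) - ι (u (α s) (y t)) -
      (s - t) • ι (u (α s) d)) 0 t := by
    rw [hasDerivAt_iff_isLittleO, ← Asymptotics.isLittleO_norm_left] at hy ⊢
    refine hy.congr_left fun s => ?_
    have h := hu.norm_map hT (α s) (y s - y t - ((s - t : ℝ) : ℂ) • d)
    simp only [map_sub, map_smul, real_smul_eq] at h ⊢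
    simpa using h.symm
  have h3 : HasDerivAt (fun s => (s - t) • ι (u (α s) d)) (ι (u (α t) d)) t := by
    have hc : ContinuousAt (fun s => ι (u (α s) d)) t :=
      ((hu.hasDerivAt (α t) d).scomp t hα).continuousAt
    rw [hasDerivAt_iff_tendsto_slope]
    refine (hc.tendsto.mono_left nhdsWithin_le_nhds).congr' ?_
    filter_upwards [self_mem_nhdsWithin] with s hs
    have hs' : s - t ≠ 0 := sub_ne_zero.2 hs
    simp [slope_def_module, smul_smul, inv_mul_cancel₀ hs']
  have h4 := (h1.add h2).add h3
  rw [add_zero] at h4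
  rw [_root_.map_add]
  refine h4.congr_of_eventuallyEq (Filter.Eventually.of_forall fun s => ?_)
  simp only [Pi.add_apply]
  abel

end Flow

end Oscillator

namespace Oscillator

/-! ### From a flow on the domain to a unitary group generated by the closure. -/

section Extension

variable {D H : Type*} [AddCommGroup D] [Module ℂ D] [NormedAddCommGroup H] [InnerProductSpace ℂ H]
  [NormedSpace ℝ H] {ι : D →ₗ[ℂ] H} {T : Module.End ℂ D} {u : ℝ → Module.End ℂ D}

/-- For the generator of a flow the range of `T + i` is dense. -/
theorem IsFlow.dense_range_add_I [CompleteSpace H] (hu : IsFlow ι T u) (hT : SymmOn ι T)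
    (hι : DenseRange ι) : Dense (LinearMap.range (ι ∘ₗ T + Complex.I • ι) : Set H) := by
  rw [Submodule.dense_iff_topologicalClosure_eq_top, Submodule.topologicalClosure_eq_top_iff,
    Submodule.eq_bot_iff]
  intro h hh
  have hperp : ∀ d, inner ℂ h (ι (T d)) = -Complex.I * inner ℂ h (ι d) := by
    intro d
    have := (Submodule.mem_orthogonal' _ _).1 hh _ ⟨d, rfl⟩
    simp only [LinearMap.add_apply, LinearMap.coe_comp, Function.comp_apply, LinearMap.smul_apply,
      inner_add_right, inner_smul_right] at this
    linear_combination this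
  -- For `h` orthogonal to the range, `⟪h, u t d⟫` equals its own derivative and so grows like
  -- `e^t`, while unitarity keeps it bounded. Hence it vanishes.
  have hzero : ∀ d, inner ℂ h (ι d) = 0 := by
    intro d
    have hφ : ∀ t, HasDerivAt (fun t => inner ℂ h (ι (u t d))) (inner ℂ h (ι (u t d))) t := by
      intro t
      have := (hasDerivAt_const t h).inner ℂ (hu.hasDerivAt t d)
      rw [inner_smul_right, hperp, ← mul_assoc] at this
      simpa using this
    have hconst : ∀ t : ℝ, Real.exp (-t) • inner ℂ h (ι (u t d)) = inner ℂ h (ι d) := by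
      intro t
      have hd : ∀ t : ℝ, HasDerivAt (fun t : ℝ => Real.exp (-t) • inner ℂ h (ι (u t d))) 0 t := by
        intro t
        have h1 : HasDerivAt (fun t : ℝ => Real.exp (-t)) (-Real.exp (-t)) t := by
          simpa using (hasDerivAt_neg t).exp
        have h2 := h1.smul (hφ t)
        rw [neg_smul, add_neg_cancel] at h2
        exact h2
      have := is_const_of_deriv_eq_zero (fun t => (hd t).differentiableAt)
        (fun t => (hd t).deriv) t 0
      simpa [hu.map_zero] using this
    have hbound : ∀ t : ℝ, ‖inner ℂ h (ι d)‖ ≤ Real.exp (-t) * (‖h‖ * ‖ι d‖) := by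
      intro t
      rw [← hconst t, norm_smul, Real.norm_of_nonneg (Real.exp_pos _).le]
      gcongr
      rw [← hu.norm_map hT t d]
      exact norm_inner_le_norm _ _
    have hlim : Filter.Tendsto (fun t : ℝ => Real.exp (-t) * (‖h‖ * ‖ι d‖)) Filter.atTop
        (nhds (0 * (‖h‖ * ‖ι d‖))) :=
      (Real.tendsto_exp_neg_atTop_nhds_zero).mul_const _
    rw [zero_mul] at hlim
    exact norm_le_zero_iff.1 (ge_of_tendsto' hlim hbound)
  have hcont : (fun x => inner ℂ h x) = fun _ => (0 : ℂ) :=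
    hι.equalizer (by fun_prop) continuous_const (funext fun d => hzero d)
  exact inner_self_eq_zero.1 (congrFun hcont h)

/-- The generator of a unitary group that extends a flow on a dense domain is the closure of the
generator of the flow. -/
theorem IsFlow.generator_iff [CompleteSpace H] (hu : IsFlow ι T u) (hT : SymmOn ι T)
    (hι : DenseRange ι) {U : ℝ → H →L[ℂ] H} (hU0 : U 0 = ContinuousLinearMap.id ℂ H)
    (hnorm : ∀ t f, ‖U t f‖ = ‖f‖) (hcont : ∀ f, Continuous fun t => U t f)
    (hUι : ∀ t f, U t (ι f) = ι (u t f)) (f g : H) :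
    HasDerivAt (fun t => U t f) (Complex.I • g) 0 ↔
      (f, g) ∈ (domGraph ι T).topologicalClosure := by
  -- A mean value estimate bounds the first-order remainder at each point `p` of the graph by `(2 *
  -- ‖p.2 - g‖ + ε) * ‖t‖`, for small `t`. This is a closed condition on `p`, and at `(f, g)` the
  -- bound is `ε * ‖t‖`.
  have hclosure : ∀ f g, (f, g) ∈ (domGraph ι T).topologicalClosure →
      HasDerivAt (fun t => U t f) (Complex.I • g) 0 := by
    intro f g hfg
    rw [hasDerivAt_iff_isLittleO, Asymptotics.isLittleO_iff]
    intro ε hε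
    have hg : ∀ᶠ s in nhds (0 : ℝ), ‖U s g - g‖ < ε := by
      have := (hcont g).tendsto 0
      rw [hU0] at this
      simpa [dist_eq_norm] using Metric.tendsto_nhds.1 this ε hε
    obtain ⟨δ, hδ, hball⟩ := Metric.eventually_nhds_iff.1 hg
    filter_upwards [Metric.ball_mem_nhds (0 : ℝ) hδ] with t ht
    have hclosed : IsClosed {p : H × H |
        ‖U t p.1 - p.1 - t • Complex.I • p.2‖ ≤ (2 * ‖p.2 - g‖ + ε) * ‖t‖} :=
      isClosed_le (by fun_prop) (by fun_prop)
    have hsub : ((domGraph ι T : Submodule ℂ (H × H)) : Set (H × H)) ⊆ {p : H × H |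
        ‖U t p.1 - p.1 - t • Complex.I • p.2‖ ≤ (2 * ‖p.2 - g‖ + ε) * ‖t‖} := by
      rintro _ ⟨d, rfl⟩
      have hderiv : ∀ s, HasDerivAt (fun s => U s (ι d) - s • Complex.I • ι (T d))
          (Complex.I • U s (ι (T d)) - Complex.I • ι (T d)) s := by
        intro s
        have h1 := hu.hasDerivAt s d
        have h2 : ι (T (u s d)) = U s (ι (T d)) := by
          rw [hUι]
          have h3 : HasDerivAt (fun r => ι (u (s + r) d)) (Complex.I • ι (T (u s d))) 0 := by
            have := (show HasDerivAt (fun s => ι (u s d)) (Complex.I • ι (T (u s d))) (s + 0) by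
              simpa using h1).comp_const_add s 0
            exact this
          have h4 : HasDerivAt (fun r => U s (ι (u r d))) (Complex.I • U s (ι (T d))) 0 := by
            have := ((U s).restrictScalars ℝ).hasFDerivAt.comp_hasDerivAt 0 (hu.hasDerivAt_zero d)
            simpa [Function.comp_def] using this
          have h5 : (fun r => ι (u (s + r) d)) = fun r => U s (ι (u r d)) := by
            funext r
            rw [hu.map_add, hUι, Module.End.mul_apply]
          rw [h5] at h3
          have := h3.unique h4
          rw [hUι] at this
          exact smul_right_injective H Complex.I_ne_zero this
        have h6 := ((hasDerivAt_id s).smul_const (Complex.I • ι (T d)))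
        rw [h2] at h1
        have h7 := h1.sub h6
        simp only [one_smul] at h7
        refine h7.congr_of_eventuallyEq (Filter.Eventually.of_forall fun r => ?_)
        simp [hUι]
      have hle : ∀ s ∈ Metric.ball (0 : ℝ) δ,
          ‖Complex.I • U s (ι (T d)) - Complex.I • ι (T d)‖ ≤ 2 * ‖ι (T d) - g‖ + ε := by
        intro s hs
        rw [← smul_sub, norm_smul, Complex.norm_I, one_mul]
        have h1 : U s (ι (T d)) - ι (T d) =
            U s (ι (T d) - g) + (U s g - g) - (ι (T d) - g) := by
          rw [map_sub]
          abel
        have h2 := hball (y := s) hs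
        rw [h1]
        calc _ ≤ ‖U s (ι (T d) - g)‖ + ‖U s g - g‖ + ‖ι (T d) - g‖ :=
              (norm_sub_le _ _).trans (by gcongr; exact norm_add_le _ _)
          _ ≤ _ := by rw [hnorm]; linarith
      have := Convex.norm_image_sub_le_of_norm_hasDerivWithin_le
        (fun s _ => (hderiv s).hasDerivWithinAt) hle (convex_ball 0 δ)
        (Metric.mem_ball_self hδ) ht
      simpa [hU0, sub_right_comm] using this
    have h := closure_minimal hsub hclosed hfg
    simpa [hU0] using h
  refine ⟨fun hfg => ?_, hclosure f g⟩
  -- The graph of the full generator of `U`. On it `T + i` is bounded below, so approximating `g + i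
  -- f` by `(T + i) d` approximates `f` and `g` simultaneously.
  let G : Submodule ℂ (H × H) :=
    { carrier := {p | HasDerivAt (fun t => U t p.1) (Complex.I • p.2) 0}
      add_mem' := by
        intro p q hp hq
        have := HasDerivAt.add hp hq
        rw [← smul_add] at this
        refine this.congr_of_eventuallyEq (Filter.Eventually.of_forall fun t => ?_)
        simp
      zero_mem' := by
        simpa using hasDerivAt_const (0 : ℝ) (0 : H)
      smul_mem' := by
        intro c p hp
        have := HasDerivAt.const_smul c hp
        rw [smul_comm] at this
        refine this.congr_of_eventuallyEq (Filter.Eventually.of_forall fun t => ?_)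
        simp }
  have hGle : ∀ p ∈ domGraph ι T, p ∈ G := fun p hp =>
    hclosure p.1 p.2 (subset_closure hp)
  have hGsymm : ∀ p ∈ G, ‖p.2 + Complex.I • p.1‖ ^ 2 = ‖p.2‖ ^ 2 + ‖p.1‖ ^ 2 := by
    intro p hp
    have h1 : HasDerivAt (fun t => inner ℂ (U t p.1) (U t p.1))
        (inner ℂ p.1 (Complex.I • p.2) + inner ℂ (Complex.I • p.2) p.1) 0 := by
      have := HasDerivAt.inner ℂ hp hp
      simp only [hU0, ContinuousLinearMap.id_apply] at this
      exact this
    have h2 : (fun t => inner ℂ (U t p.1) (U t p.1)) = fun _ => ((‖p.1‖ : ℂ) ^ 2) := by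
      funext t
      rw [inner_self_eq_norm_sq_to_K, hnorm]
      rfl
    rw [h2] at h1
    have h3 := h1.unique (hasDerivAt_const _ _)
    rw [inner_smul_left, inner_smul_right, ← inner_conj_symm p.1 p.2] at h3
    have h4 : (inner ℂ p.2 p.1).im = 0 := by
      generalize inner ℂ p.2 p.1 = z at h3
      have := congrArg Complex.re h3
      simp at this
      linarith
    rw [norm_add_sq (𝕜 := ℂ), inner_smul_right, norm_smul]
    simp [h4]
  rw [← SetLike.mem_coe, Submodule.topologicalClosure_coe, Metric.mem_closure_iff]
  intro ε hε
  obtain ⟨_, ⟨d, rfl⟩, hd⟩ := Metric.mem_closure_iff.1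
    (hu.dense_range_add_I hT hι (g + Complex.I • f)) ε hε
  refine ⟨_, mem_domGraph ι T d, ?_⟩
  have hmem : ((f, g) - (ι d, ι (T d))) ∈ G := G.sub_mem hfg (hGle _ (mem_domGraph ι T d))
  have hn := hGsymm _ hmem
  have hlt : ‖g - ι (T d) + Complex.I • (f - ι d)‖ < ε := by
    rw [dist_eq_norm] at hd
    refine lt_of_eq_of_lt (congrArg _ ?_) hd
    simp only [LinearMap.add_apply, LinearMap.coe_comp, Function.comp_apply, LinearMap.smul_apply,
      smul_sub]
    abel
  simp only [Prod.mk_sub_mk] at hn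
  rw [dist_eq_norm, Prod.mk_sub_mk, Prod.norm_def, max_lt_iff]
  constructor <;> refine lt_of_pow_lt_pow_left₀ 2 hε.le ?_ <;>
    nlinarith [sq_nonneg ‖f - ι d‖, sq_nonneg ‖g - ι (T d)‖, norm_nonneg (g - ι (T d) + Complex.I • (f - ι d))]

/-- A flow of a symmetric operator on a dense domain extends to a strongly continuous unitary
group generated by the closure of the operator. -/
theorem IsFlow.exists_group [CompleteSpace H] (hu : IsFlow ι T u) (hT : SymmOn ι T)
    (hι : DenseRange ι) : ∃ U : ℝ → H →L[ℂ] H, U 0 = ContinuousLinearMap.id ℂ H ∧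
      (∀ s t, U (s + t) = U s ∘L U t) ∧ (∀ t f, ‖U t f‖ = ‖f‖) ∧
      (∀ f, Continuous fun t => U t f) ∧
      (∀ f g, HasDerivAt (fun t => U t f) (Complex.I • g) 0 ↔
        (f, g) ∈ (domGraph ι T).topologicalClosure) ∧ ∀ t f, U t (ι f) = ι (u t f) := by
  let U : ℝ → H →L[ℂ] H := fun t => (ι ∘ₗ u t).extendOfNorm ι
  have hUι : ∀ t f, U t (ι f) = ι (u t f) := fun t f =>
    LinearMap.extendOfNorm_eq hι ⟨1, fun f => by simp [hu.norm_map hT]⟩ f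
  have hext : ∀ {A B : H →L[ℂ] H}, (∀ f, A (ι f) = B (ι f)) → A = B := fun {A B} h =>
    ContinuousLinearMap.ext fun f =>
      congrFun (hι.equalizer A.continuous B.continuous (funext h)) f
  have hU0 : U 0 = ContinuousLinearMap.id ℂ H := hext fun f => by simp [hUι, hu.map_zero]
  have hU : ∀ s t, U (s + t) = U s ∘L U t := fun s t =>
    hext fun f => by simp [hUι, hu.map_add]
  have hnorm : ∀ t f, ‖U t f‖ = ‖f‖ := fun t f =>
    congrFun (hι.equalizer (g := fun f => ‖U t f‖) (h := fun f => ‖f‖) (by fun_prop) (by fun_prop)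
      (funext fun f => by simp [hUι, hu.norm_map hT])) f
  have hcont : ∀ f, Continuous fun t => U t f := by
    intro f
    rw [continuous_iff_continuousAt]
    intro t
    rw [Metric.continuousAt_iff']
    intro ε hε
    obtain ⟨d, hd⟩ := hι.exists_dist_lt f (show 0 < ε / 3 by linarith)
    have h1 := (hu.hasDerivAt t d).continuousAt
    filter_upwards [Metric.continuousAt_iff'.1 h1 (ε / 3) (by linarith)] with s hs
    have h2 : ∀ r, dist (U r f) (ι (u r d)) = dist f (ι d) := fun r => by
      rw [← hUι, dist_eq_norm, ← map_sub, hnorm, dist_eq_norm]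
    calc dist (U s f) (U t f) ≤ dist (U s f) (ι (u s d)) + dist (ι (u s d)) (ι (u t d)) +
          dist (ι (u t d)) (U t f) := dist_triangle4 _ _ _ _
      _ < ε := by
        rw [dist_comm (ι (u t d)), h2, h2]
        linarith
  exact ⟨U, hU0, hU, hnorm, hcont, hu.generator_iff hT hι hU0 hnorm hcont hUι, hUι⟩

end Extension

end Oscillator

namespace Oscillator

/-! ### The three-factor identity in `SL₂`. -/

section Factorization

variable {D H : Type*} [AddCommGroup D] [Module ℂ D] [NormedAddCommGroup H] [InnerProductSpace ℂ H]
  [NormedSpace ℝ H] [IsScalarTower ℝ ℂ H] {ι : D →ₗ[ℂ] H}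

/-- The coefficients of the vector field of the three-factor product, for
`α = tan x / r` and `β = sin (2 x) / r`. -/
theorem coefficients_three_factor {r x : ℝ} (hr : r ≠ 0) (hx : Real.cos x ≠ 0) {α β α' β' : ℝ}
    (hα : α = Real.tan x / r) (hβ : β = Real.sin (2 * x) / r)
    (hα' : α' = 1 / Real.cos x ^ 2 / 4) (hβ' : β' = Real.cos (2 * x) / 2) :
    β' + α' * (β ^ 2 * r ^ 2) = 1 / 2 ∧
    β' * α + α' * (β ^ 2 * r ^ 2 * α - β) = 0 ∧
    α' + β' * (α ^ 2 * r ^ 2) +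
      α' * (1 - β * (2 * α * r ^ 2) + β ^ 2 * r ^ 2 * (α ^ 2 * r ^ 2)) = 1 / 2 := by
  have hs : Real.sin x ^ 2 = 1 - Real.cos x ^ 2 := Real.sin_sq x
  rw [Real.tan_eq_sin_div_cos] at hα
  rw [Real.sin_two_mul] at hβ
  rw [Real.cos_two_mul] at hβ'
  generalize Real.cos x = c at *
  generalize Real.sin x = s at *
  have hαr : α * r = s / c := by rw [hα]; field_simp
  have hβr : β * r = 2 * s * c := by rw [hβ]; field_simp
  have h1 : α ^ 2 * r ^ 2 = (1 - c ^ 2) / c ^ 2 := by rw [← mul_pow, hαr, div_pow, hs]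
  have h2 : β ^ 2 * r ^ 2 = 4 * (1 - c ^ 2) * c ^ 2 := by rw [← mul_pow, hβr, ← hs]; ring
  have h3 : β * (2 * α * r ^ 2) = 4 * (1 - c ^ 2) := by
    calc β * (2 * α * r ^ 2) = 2 * (α * r) * (β * r) := by ring
      _ = 4 * s ^ 2 := by rw [hαr, hβr]; field_simp; ring
      _ = _ := by rw [hs]
  refine ⟨?_, ?_, ?_⟩
  · rw [h2, hα', hβ']
    field_simp
    ring
  · rw [h2, hα', hβ', hα, hβ]
    field_simp
    ring
  · rw [h1, h2, h3, hα', hβ']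
    field_simp
    ring

/-- If the flows `A` of `F` and `B` of `E` act on the span of `E`, `K`, `F` as the two unipotent
subgroups of `SL₂` in its adjoint representation, then `A B A`, with suitable parameters,
solves the evolution equation of `(E + F) / 2`. -/
theorem isLocalFlow_three_factor {E F K : Module.End ℂ D} {A B : ℝ → Module.End ℂ D}
    (hA : IsFlow ι F A) (hB : IsFlow ι E B) (hF : SymmOn ι F) (hE : SymmOn ι E)
    {r : ℝ} (hr : 0 < r)
    (hAF : ∀ α, A α * F = F * A α)
    (hAK : ∀ α : ℝ, A α * K = (K + ((2 * α * r ^ 2 : ℝ) : ℂ) • F) * A α)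
    (hAE : ∀ α : ℝ, A α * E = (E + (α : ℂ) • K + ((α ^ 2 * r ^ 2 : ℝ) : ℂ) • F) * A α)
    (hBF : ∀ β : ℝ, B β * F = (F - (β : ℂ) • K + ((β ^ 2 * r ^ 2 : ℝ) : ℂ) • E) * B β) :
    IsLocalFlow ι ((1 / 2 : ℂ) • (E + F)) (2 * Real.pi / r) (fun t =>
      A (Real.tan (r * t / 4) / r) * B (Real.sin (r * t / 2) / r) *
        A (Real.tan (r * t / 4) / r)) where
  map_zero := by simp [hA.map_zero, hB.map_zero]
  hasDerivAt t ht f := by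
    -- The window `|t| < 2π / r` is exactly `|r t / 4| < π / 2`, the range up to the first poles of
    -- the tangent.
    have hcos : Real.cos (r * t / 4) ≠ 0 := by
      refine (Real.cos_pos_of_mem_Ioo ⟨?_, ?_⟩).ne'
      · have := ht.1
        rw [← neg_div, div_lt_iff₀ hr] at this
        linarith
      · have := ht.2
        rw [lt_div_iff₀ hr] at this
        linarith
    have hα : HasDerivAt (fun t => Real.tan (r * t / 4) / r)
        (1 / Real.cos (r * t / 4) ^ 2 / 4) t := by
      have h1 : HasDerivAt (fun t => r * t / 4) (r * 1 / 4) t :=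
        ((hasDerivAt_id t).const_mul r).div_const 4
      refine (((Real.hasDerivAt_tan hcos).comp t h1).div_const r).congr_deriv ?_
      field_simp
    have hβ : HasDerivAt (fun t => Real.sin (r * t / 2) / r)
        (Real.cos (2 * (r * t / 4)) / 2) t := by
      have h1 : HasDerivAt (fun t => r * t / 2) (r * 1 / 2) t :=
        ((hasDerivAt_id t).const_mul r).div_const 2
      refine (((Real.hasDerivAt_sin _).comp t h1).div_const r).congr_deriv ?_
      rw [show 2 * (r * t / 4) = r * t / 2 by ring]
      field_simp
    obtain ⟨e1, e2, e3⟩ := coefficients_three_factor hr.ne' hcos rfl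
      (show Real.sin (r * t / 2) / r = _ by rw [show 2 * (r * t / 4) = r * t / 2 by ring]) rfl rfl
    have h0 : HasDerivAt (fun _ : ℝ => ι f) (ι 0) t := by simpa using hasDerivAt_const t (ι f)
    have h := hA.hasDerivAt_comp hF hα (hB.hasDerivAt_comp hE hβ (hA.hasDerivAt_comp hF hα h0))
    refine h.congr_deriv ?_
    generalize Real.tan (r * t / 4) / r = α at *
    generalize Real.sin (r * t / 2) / r = β at *
    generalize 1 / Real.cos (r * t / 4) ^ 2 / 4 = α' at *
    generalize Real.cos (2 * (r * t / 4)) / 2 = β' at *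
    have key : (α' : ℂ) • (F * (A α * B β * A α)) + (β' : ℂ) • (A α * E * B β * A α) +
        (α' : ℂ) • (A α * (B β * F) * A α) = ((1 / 2 : ℂ) • (E + F)) * (A α * B β * A α) := by
      have hABF : A α * (B β * F) = (F - (β : ℂ) • (K + ((2 * α * r ^ 2 : ℝ) : ℂ) • F) +
          ((β ^ 2 * r ^ 2 : ℝ) : ℂ) •
            (E + (α : ℂ) • K + ((α ^ 2 * r ^ 2 : ℝ) : ℂ) • F)) * A α * B β := by
        rw [hBF, ← mul_assoc]
        congr 1
        simp only [mul_add, mul_sub, add_mul, sub_mul, mul_smul_comm, smul_mul_assoc, hAF, hAK, hAE]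
      have e1' : (β' + α' * (β ^ 2 * r ^ 2) : ℂ) = 1 / 2 := by
        simpa using congrArg Complex.ofReal e1
      have e2' : (β' * α + α' * (β ^ 2 * r ^ 2 * α - β) : ℂ) = 0 := by
        simpa using congrArg Complex.ofReal e2
      have e3' : (α' + β' * (α ^ 2 * r ^ 2) +
          α' * (1 - β * (2 * α * r ^ 2) + β ^ 2 * r ^ 2 * (α ^ 2 * r ^ 2)) : ℂ) = 1 / 2 := by
        simpa using congrArg Complex.ofReal e3
      rw [hABF, hAE]
      -- Contributions of the left, middle and right factors, with generators moved to the left. The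
      -- coefficients of `F`, `E`, `K` are `1/2`, `1/2`, `0`.
      have hfac : (α' : ℂ) • F + (β' : ℂ) • (E + (α : ℂ) • K + ((α ^ 2 * r ^ 2 : ℝ) : ℂ) • F) +
          (α' : ℂ) • (F - (β : ℂ) • (K + ((2 * α * r ^ 2 : ℝ) : ℂ) • F) +
          ((β ^ 2 * r ^ 2 : ℝ) : ℂ) • (E + (α : ℂ) • K + ((α ^ 2 * r ^ 2 : ℝ) : ℂ) • F)) =
          (1 / 2 : ℂ) • (E + F) := by
        push_cast
        match_scalars
        · linear_combination e3'
        · linear_combination e1'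
        · linear_combination e2'
      rw [← hfac]
      simp only [add_mul, smul_mul_assoc, mul_assoc]
    have := congrArg (fun S => Complex.I • S f) key
    simp only [Module.End.mul_apply, LinearMap.add_apply, LinearMap.smul_apply] at this ⊢
    rw [← map_smul ι, ← this]
    simp only [map_add, map_smul, map_zero, add_zero, smul_add, smul_smul, mul_comm, add_assoc]

end Factorization

/-! ### Exponentials on `L²` computed from flows on Schwartz functions. -/

section Exponential

noncomputable section

variable {n : ℕ}

/-- The inclusion of the Schwartz functions into `L²(ℝⁿ)`. -/
def toL2 (n : ℕ) : Schw n →ₗ[ℂ] Hilb n :=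
  (SchwartzMap.toLpCLM ℂ ℂ 2 (volume : Measure (Config n))).toLinearMap

theorem toL2_injective : Function.Injective (toL2 n) :=
  SchwartzMap.injective_toLp 2 (volume : Measure (Config n))

theorem toL2_denseRange : DenseRange (toL2 n) :=
  SchwartzMap.denseRange_toLpCLM (F := ℂ) (by norm_num : (2 : ENNReal) ≠ ⊤)
    (μ := (volume : Measure (Config n)))

theorem hilb_ext {A B : Hilb n →L[ℂ] Hilb n} (h : ∀ f, A (toL2 n f) = B (toL2 n f)) : A = B :=
  ContinuousLinearMap.ext fun f =>
    congrFun (toL2_denseRange.equalizer A.continuous B.continuous (funext h)) f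

theorem dense_domain_schwartzGraph (T : Schw n →L[ℂ] Schw n) :
    Dense {f : Hilb n | ∃ g, (f, g) ∈ (schwartzGraph T).topologicalClosure} := by
  refine Dense.mono ?_ (toL2_denseRange (n := n))
  rintro _ ⟨f, rfl⟩
  exact ⟨_, subset_closure (mem_domGraph (toL2 n) T.toLinearMap f)⟩

/-- A symmetric operator with a flow on the Schwartz functions has a well-defined exponential,
which extends the flow. -/
theorem IsFlow.expI_apply {T : Schw n →L[ℂ] Schw n} {u : ℝ → Module.End ℂ (Schw n)}
    (hu : IsFlow (toL2 n) T.toLinearMap u) (hT : SymmOn (toL2 n) T.toLinearMap) :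
    HasExp T ∧ ∀ t f, expI t T (toL2 n f) = toL2 n (u t f) := by
  obtain ⟨U, hU0, hU, hnorm, hcont, hgen, hUι⟩ := hu.exists_group hT toL2_denseRange
  have hUexp : IsExpGroup T U := ⟨hU0, hU, hnorm, hcont, hgen⟩
  have hexp : HasExp T := ⟨U, hUexp, fun V hV =>
    hT.symmGraph.topologicalClosure.group_unique (dense_domain_schwartzGraph T)
      hV.map_zero hU0 hV.map_add hU hV.generator hgen⟩
  refine ⟨hexp, fun t f => ?_⟩
  have hch : hexp.choose = U := hexp.unique hexp.choose_spec.1 hUexp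
  rw [expI, dif_pos hexp, hch, hUι]

/-- The local flow extends to a global one, which yields the exponential; by uniqueness the two
agree on the whole window, not just near `0`. -/
theorem IsLocalFlow.expI_apply {T : Schw n →L[ℂ] Schw n} {W : ℝ → Module.End ℂ (Schw n)} {a : ℝ}
    (ha : 0 < a) (hW : IsLocalFlow (toL2 n) T.toLinearMap a W)
    (hT : SymmOn (toL2 n) T.toLinearMap) :
    HasExp T ∧ ∀ t ∈ Set.Ioo (-a) a, ∀ f, expI t T (toL2 n f) = toL2 n (W t f) := by
  obtain ⟨u, hu⟩ := hW.exists_isFlow ha hT toL2_injective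
  refine ⟨(hu.expI_apply hT).1, fun t ht f => ?_⟩
  rw [(hu.expI_apply hT).2]
  congr 1
  exact hT.trajectory_eq toL2_injective (y := fun t => u t f) (z := fun t => W t f)
    isOpen_Ioo isPreconnected_Ioo (fun t _ => hu.hasDerivAt t f) (fun t ht => hW.hasDerivAt t ht f)
    (a := 0) ⟨by linarith, ha⟩ ht (by simp [hu.map_zero, hW.map_zero])

end

end Exponential

end Oscillator

namespace Oscillator

/-! ### Position, momentum and quadratic phases on Schwartz functions. -/

noncomputable section

variable {n : ℕ}

open FourierTransform

/-- All derivatives have modulus one. -/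
theorem hasTemperateGrowth_cexp_mul_I :
    Function.HasTemperateGrowth (fun s : ℝ => Complex.exp (s * Complex.I)) := by
  have hderiv : ∀ k : ℕ, iteratedDeriv k (fun s : ℝ => Complex.exp (s * Complex.I)) =
      fun s : ℝ => Complex.I ^ k * Complex.exp (s * Complex.I) := by
    intro k
    induction k with
    | zero => simp
    | succ k ih =>
      funext s
      rw [iteratedDeriv_succ, ih]
      have h : HasDerivAt (fun s : ℝ => Complex.exp (s * Complex.I))
          (Complex.exp (s * Complex.I) * (1 * Complex.I)) s :=
        ((Complex.ofRealCLM.hasDerivAt).mul_const Complex.I).cexp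
      rw [(h.const_mul (Complex.I ^ k)).deriv]
      ring
  refine ⟨?_, fun k => ⟨0, 1, fun s => ?_⟩⟩
  · exact (Complex.ofRealCLM.contDiff.mul contDiff_const).cexp
  · rw [norm_iteratedFDeriv_eq_norm_iteratedDeriv, hderiv]
    simp [Complex.norm_exp_ofReal_mul_I]

theorem hasTemperateGrowth_linear (u : Config n) :
    Function.HasTemperateGrowth (fun x : Config n => ((inner ℝ u x : ℝ) : ℂ)) := by
  fun_prop

/-- The function `x ↦ e^{i t ⟪u, x⟫ ⟪v, x⟫}`. -/
def phase (u v : Config n) (t : ℝ) (x : Config n) : ℂ :=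
  Complex.exp ((t * (inner ℝ u x * inner ℝ v x) : ℝ) * Complex.I)

theorem hasTemperateGrowth_phase (u v : Config n) (t : ℝ) :
    Function.HasTemperateGrowth (phase u v t) := by
  have h : Function.HasTemperateGrowth
      (fun x : Config n => t * (inner ℝ u x * inner ℝ v x) : Config n → ℝ) := by
    fun_prop
  exact hasTemperateGrowth_cexp_mul_I.comp h

/-- Multiplication by the linear function `⟪u, ·⟫`. -/
def posAlong (u : Config n) : Module.End ℂ (Schw n) :=
  (SchwartzMap.smulLeftCLM ℂ (fun x : Config n => ((inner ℝ u x : ℝ) : ℂ))).toLinearMap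

/-- The operator `-i ∂_u`. -/
def momAlong (u : Config n) : Module.End ℂ (Schw n) :=
  (-Complex.I) • (LineDeriv.lineDerivOpCLM ℂ (Schw n) u).toLinearMap

/-- Multiplication by `e^{i t ⟪u, x⟫ ⟪v, x⟫}`. -/
def phaseMul (u v : Config n) (t : ℝ) : Module.End ℂ (Schw n) :=
  (SchwartzMap.smulLeftCLM ℂ (phase u v t)).toLinearMap

theorem posAlong_apply (u : Config n) (f : Schw n) (x : Config n) :
    posAlong u f x = (inner ℝ u x : ℝ) * f x := by
  simp [posAlong, SchwartzMap.smulLeftCLM_apply_apply (hasTemperateGrowth_linear u)]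

theorem momAlong_apply (u : Config n) (f : Schw n) (x : Config n) :
    momAlong u f x = -Complex.I * lineDeriv ℝ f x u := by
  simp [momAlong, SchwartzMap.lineDerivOp_apply]

theorem phaseMul_apply (u v : Config n) (t : ℝ) (f : Schw n) (x : Config n) :
    phaseMul u v t f x = phase u v t x * f x := by
  simp [phaseMul, SchwartzMap.smulLeftCLM_apply_apply (hasTemperateGrowth_phase u v t)]

theorem posAlong_add (u v : Config n) : posAlong (u + v) = posAlong u + posAlong v := by
  ext f x
  simp [posAlong_apply, inner_add_left, add_mul]

theorem posAlong_smul (c : ℝ) (u : Config n) : posAlong (c • u) = (c : ℂ) • posAlong u := by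
  ext f x
  simp [posAlong_apply, inner_smul_left, mul_assoc]

theorem momAlong_add (u v : Config n) : momAlong (u + v) = momAlong u + momAlong v := by
  ext f x
  simp [momAlong, LineDeriv.lineDerivOp_left_add]
  ring

theorem momAlong_smul (c : ℝ) (u : Config n) : momAlong (c • u) = (c : ℂ) • momAlong u := by
  ext f x
  simp [momAlong, LineDeriv.lineDerivOp_left_smul, mul_left_comm]

theorem posAlong_comm (u v : Config n) : posAlong u * posAlong v = posAlong v * posAlong u := by
  ext f x
  simp [posAlong_apply, mul_left_comm]

theorem hasLineDerivAt_schw (f : Schw n) (x w : Config n) :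
    HasLineDerivAt ℝ f (lineDeriv ℝ f x w) x w :=
  (f.differentiableAt.lineDifferentiableAt).hasLineDerivAt

theorem momAlong_posAlong (w u : Config n) :
    momAlong w * posAlong u = posAlong u * momAlong w - (inner ℝ u w * Complex.I) • 1 := by
  ext f x
  have h1 : HasLineDerivAt ℝ (posAlong u f)
      ((inner ℝ u w : ℝ) * f x + (inner ℝ u x : ℝ) * lineDeriv ℝ f x w) x w := by
    have h2 : HasDerivAt (fun s : ℝ => ((inner ℝ u (x + s • w) : ℝ) : ℂ)) (inner ℝ u w : ℝ) 0 := by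
      have h3 : HasDerivAt (fun s : ℝ => inner ℝ u x + s * inner ℝ u w) (inner ℝ u w) 0 := by
        simpa using ((hasDerivAt_id (0 : ℝ)).mul_const (inner ℝ u w)).const_add (inner ℝ u x)
      simpa [inner_add_right, inner_smul_right] using h3.ofReal_comp
    have h4 := h2.mul (hasLineDerivAt_schw f x w)
    have h5 : ⇑(posAlong u f) = fun x => ((inner ℝ u x : ℝ) : ℂ) * f x :=
      funext (posAlong_apply u f)
    rw [HasLineDerivAt, h5]
    refine HasDerivAt.congr_deriv h4 ?_
    simp
  simp only [Module.End.mul_apply, LinearMap.sub_apply, LinearMap.smul_apply, Module.End.one_apply,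
    sub_apply, smul_apply, posAlong_apply, momAlong_apply, h1.lineDeriv,
    smul_eq_mul]
  ring

theorem phaseMul_posAlong (u v w : Config n) (t : ℝ) :
    SemiconjBy (phaseMul u v t) (posAlong w) (posAlong w) := by
  ext f x
  simp [posAlong_apply, phaseMul_apply, mul_left_comm]

theorem phaseMul_momAlong (u v w : Config n) (t : ℝ) :
    SemiconjBy (phaseMul u v t) (momAlong w) (momAlong w -
      (t : ℂ) • ((inner ℝ u w : ℂ) • posAlong v + (inner ℝ v w : ℂ) • posAlong u)) := by
  ext f x
  have h1 : HasLineDerivAt ℝ (phaseMul u v t f)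
      (phase u v t x * (t * (inner ℝ u w * inner ℝ v x + inner ℝ u x * inner ℝ v w) * Complex.I) *
        f x + phase u v t x * lineDeriv ℝ f x w) x w := by
    have h2 : HasDerivAt (fun s : ℝ => phase u v t (x + s • w)) (phase u v t x *
        (t * (inner ℝ u w * inner ℝ v x + inner ℝ u x * inner ℝ v w) * Complex.I)) 0 := by
      have h3 : ∀ u : Config n,
          HasDerivAt (fun s : ℝ => inner ℝ u (x + s • w)) (inner ℝ u w) 0 := by
        intro u
        simpa [inner_add_right, inner_smul_right] using
          ((hasDerivAt_id (0 : ℝ)).mul_const (inner ℝ u w)).const_add (inner ℝ u x)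
      have h4 := ((((h3 u).mul (h3 v)).const_mul t).ofReal_comp.mul_const Complex.I).cexp
      simpa [phase] using h4
    have h4 := h2.mul (hasLineDerivAt_schw f x w)
    have h5 : ⇑(phaseMul u v t f) = fun x => phase u v t x * f x :=
      funext (phaseMul_apply u v t f)
    rw [HasLineDerivAt, h5]
    refine HasDerivAt.congr_deriv h4 ?_
    simp
  simp only [Module.End.mul_apply, LinearMap.sub_apply, LinearMap.smul_apply, LinearMap.add_apply,
    sub_apply, smul_apply, add_apply, posAlong_apply,
    phaseMul_apply, momAlong_apply, h1.lineDeriv, smul_eq_mul]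
  linear_combination (phase u v t x * f x * t *
    (inner ℝ u w * inner ℝ v x + inner ℝ u x * inner ℝ v w)) * Complex.I_sq

theorem norm_toL2_le {f g : Schw n} {C : ℝ} (h : ∀ x, ‖f x‖ ≤ C * ‖g x‖) :
    ‖toL2 n f‖ ≤ C * ‖toL2 n g‖ := by
  refine Lp.norm_le_mul_norm_of_ae_le_mul ?_
  filter_upwards [f.coeFn_toLp 2 volume, g.coeFn_toLp 2 volume] with x hf hg
  change ‖(f.toLp 2 volume) x‖ ≤ C * ‖(g.toLp 2 volume) x‖
  rw [hf, hg]
  exact h x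

theorem norm_cexp_mul_I_sub_le (s : ℝ) :
    ‖Complex.exp (s * Complex.I) - 1 - s * Complex.I‖ ≤ 2 * s ^ 2 := by
  rcases le_total |s| 1 with h | h
  · have := Complex.norm_exp_sub_one_sub_id_le (x := s * Complex.I) (by simpa using h)
    refine this.trans ?_
    simp only [norm_mul, Complex.norm_real, Complex.norm_I, mul_one, Real.norm_eq_abs, sq_abs]
    nlinarith [sq_nonneg s]
  · have h1 := Real.norm_exp_I_mul_ofReal_sub_one_le (x := s)
    rw [mul_comm] at h1
    calc _ ≤ ‖Complex.exp (s * Complex.I) - 1‖ + ‖s * Complex.I‖ := norm_sub_le _ _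
      _ ≤ |s| + |s| := by
        gcongr
        · exact h1
        · simp
      _ ≤ _ := by nlinarith [sq_abs s]

/-- The remainder at time `t` is bounded pointwise by `2 t²` times the modulus of the generator
applied twice to `f`, which is again Schwartz. This needs the quadratic bound on the exponential for
all real arguments, not only small ones. -/
theorem isFlow_phaseMul (u v : Config n) :
    IsFlow (toL2 n) (posAlong u * posAlong v) (phaseMul u v) where
  map_zero := by
    ext f x
    simp [phaseMul_apply, phase]
  map_add s t := by
    ext f x
    simp only [phaseMul_apply, Module.End.mul_apply, phase, ← mul_assoc, ← Complex.exp_add]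
    congr 2
    push_cast
    ring
  hasDerivAt_zero f := by
    rw [hasDerivAt_iff_isLittleO]
    refine Asymptotics.IsBigO.trans_isLittleO (g := fun t : ℝ => t ^ 2) ?_ ?_
    · refine Asymptotics.IsBigO.of_bound
        (2 * ‖toL2 n ((posAlong u * posAlong v) ((posAlong u * posAlong v) f))‖)
        (Filter.Eventually.of_forall fun t => ?_)
      have h : toL2 n (phaseMul u v t f) - toL2 n (phaseMul u v 0 f) -
          (t - 0) • Complex.I • toL2 n ((posAlong u * posAlong v) f) =
          toL2 n (phaseMul u v t f - f -
            ((t : ℂ) * Complex.I) • (posAlong u * posAlong v) f) := by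
        have h0 : phaseMul u v 0 f = f := by
          ext x
          simp [phaseMul_apply, phase]
        rw [h0, sub_zero, real_smul_eq, map_sub, map_sub, map_smul, smul_smul]
      rw [h, norm_pow, Real.norm_eq_abs, sq_abs, mul_right_comm]
      refine norm_toL2_le fun x => ?_
      simp only [sub_apply, smul_apply, Module.End.mul_apply,
        posAlong_apply, phaseMul_apply, smul_eq_mul]
      have h2 := norm_cexp_mul_I_sub_le (t * (inner ℝ u x * inner ℝ v x))
      calc _ = ‖(phase u v t x - 1 -
            ((t * (inner ℝ u x * inner ℝ v x) : ℝ) : ℂ) * Complex.I) * f x‖ := by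
            congr 1
            push_cast
            ring
        _ ≤ 2 * (t * (inner ℝ u x * inner ℝ v x)) ^ 2 * ‖f x‖ := by
            rw [norm_mul]
            gcongr
            exact h2
        _ = _ := by
            simp only [norm_mul, Complex.norm_real, Real.norm_eq_abs]
            rw [mul_pow, mul_pow, ← sq_abs (inner ℝ u x), ← sq_abs (inner ℝ v x)]
            ring
    · simpa using Asymptotics.isLittleO_pow_pow (𝕜 := ℝ) (m := 1) (n := 2) (by norm_num)

theorem symmOn_posAlong (u : Config n) : SymmOn (toL2 n) (posAlong u) := by
  intro f g
  change inner ℂ ((posAlong u f).toLp 2 volume) (g.toLp 2 volume) =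
    inner ℂ (f.toLp 2 volume) ((posAlong u g).toLp 2 volume)
  refine (SchwartzMap.inner_toL2_toL2_eq _ _ volume).trans
    (Eq.trans ?_ (SchwartzMap.inner_toL2_toL2_eq _ _ volume).symm)
  congr 1
  funext x
  simp only [posAlong_apply, RCLike.inner_apply, map_mul, Complex.conj_ofReal]
  ring

/-! ### Fourier conjugation and momentum phases. -/

/-- The Fourier transform on Schwartz functions. -/
def fourierEnd (n : ℕ) : Module.End ℂ (Schw n) :=
  (SchwartzMap.fourierTransformCLM ℂ : Schw n →L[ℂ] Schw n).toLinearMap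

/-- The inverse Fourier transform on Schwartz functions. -/
def fourierInvEnd (n : ℕ) : Module.End ℂ (Schw n) where
  toFun f := 𝓕⁻ f
  map_add' := FourierTransform.fourierInv_add
  map_smul' := FourierTransform.fourierInv_smul

theorem fourierEnd_apply (f : Schw n) : fourierEnd n f = 𝓕 f := rfl

theorem fourierInvEnd_apply (f : Schw n) : fourierInvEnd n f = 𝓕⁻ f := rfl

theorem fourierEnd_mul_fourierInvEnd : fourierEnd n * fourierInvEnd n = 1 :=
  LinearMap.ext fun f => by
    rw [Module.End.mul_apply, fourierEnd_apply, fourierInvEnd_apply, Module.End.one_apply,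
      FourierTransform.fourier_fourierInv_eq]

theorem fourierInvEnd_mul_fourierEnd : fourierInvEnd n * fourierEnd n = 1 :=
  LinearMap.ext fun f => by
    rw [Module.End.mul_apply, fourierEnd_apply, fourierInvEnd_apply, Module.End.one_apply,
      FourierTransform.fourierInv_fourier_eq]

theorem inner_fourierEnd (f g : Schw n) :
    inner ℂ (toL2 n (fourierEnd n f)) (toL2 n (fourierEnd n g)) =
      inner ℂ (toL2 n f) (toL2 n g) :=
  SchwartzMap.inner_fourier_toL2_eq f g

theorem norm_fourierInvEnd (f : Schw n) : ‖toL2 n (fourierInvEnd n f)‖ = ‖toL2 n f‖ := by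
  have h : ‖toL2 n (fourierEnd n (fourierInvEnd n f))‖ = ‖toL2 n (fourierInvEnd n f)‖ :=
    SchwartzMap.norm_fourier_toL2_eq (fourierInvEnd n f)
  rw [← h, ← Module.End.mul_apply, fourierEnd_mul_fourierInvEnd, Module.End.one_apply]

theorem smulLeftCLM_real_eq (w : Config n) (f : Schw n) :
    SchwartzMap.smulLeftCLM ℂ (fun x : Config n => (inner ℝ x w : ℝ)) f = posAlong w f := by
  ext x
  rw [posAlong_apply, SchwartzMap.smulLeftCLM_apply_apply (Function.hasTemperateGrowth_inner_left w),
    real_inner_comm]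
  simp

/-- The factor `2π` comes from the normalization `e^{2πi⟪x, ξ⟫}` of the Fourier kernel. -/
theorem fourierInvEnd_posAlong (w : Config n) :
    SemiconjBy (fourierInvEnd n) (posAlong ((2 * Real.pi) • w)) (momAlong w) := by
  ext1 f
  have h := SchwartzMap.lineDerivOp_fourierInv_eq f w
  rw [smulLeftCLM_real_eq] at h
  change 𝓕⁻ (posAlong ((2 * Real.pi) • w) f) = -Complex.I • ∂_{w} (𝓕⁻ f)
  rw [h, posAlong_smul, ← FourierTransform.fourierInv_smul, smul_smul]
  congr 1
  rw [LinearMap.smul_apply]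
  congr 1
  push_cast
  linear_combination (2 * Real.pi : ℂ) * Complex.I_sq

theorem fourierInvEnd_momAlong (w : Config n) :
    SemiconjBy (fourierInvEnd n) (momAlong w) (-posAlong ((2 * Real.pi) • w)) := by
  ext1 f
  have h := SchwartzMap.fourierInv_lineDerivOp_eq f w
  rw [smulLeftCLM_real_eq] at h
  change 𝓕⁻ (-Complex.I • ∂_{w} f) = -posAlong ((2 * Real.pi) • w) (𝓕⁻ f)
  rw [FourierTransform.fourierInv_smul, h, posAlong_smul, LinearMap.smul_apply, smul_smul,
    ← neg_smul]
  congr 1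
  push_cast
  linear_combination (2 * Real.pi : ℂ) * Complex.I_sq

theorem semiconjBy_symm {R : Type*} [Monoid R] {a a' x y : R} (h : SemiconjBy a x y)
    (h1 : a * a' = 1) (h2 : a' * a = 1) : SemiconjBy a' y x := by
  calc a' * y = a' * (y * a) * a' := by rw [mul_assoc, mul_assoc y, h1, mul_one]
    _ = x * a' := by rw [← h.eq, ← mul_assoc a', h2, one_mul]

theorem fourierEnd_momAlong (w : Config n) :
    SemiconjBy (fourierEnd n) (momAlong w) (posAlong ((2 * Real.pi) • w)) :=
  semiconjBy_symm (fourierInvEnd_posAlong w) fourierInvEnd_mul_fourierEnd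
    fourierEnd_mul_fourierInvEnd

theorem fourierEnd_posAlong (w : Config n) :
    SemiconjBy (fourierEnd n) (posAlong ((2 * Real.pi) • w)) (-momAlong w) := by
  have := semiconjBy_symm (fourierInvEnd_momAlong w) fourierInvEnd_mul_fourierEnd
    fourierEnd_mul_fourierInvEnd
  simpa using this.neg_right

theorem symmOn_momAlong (u : Config n) : SymmOn (toL2 n) (momAlong u) := by
  intro f g
  have h := symmOn_posAlong ((2 * Real.pi) • u) (fourierEnd n f) (fourierEnd n g)
  rw [← Module.End.mul_apply, ← Module.End.mul_apply, ← (fourierEnd_momAlong u).eq,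
    Module.End.mul_apply, Module.End.mul_apply, inner_fourierEnd, inner_fourierEnd] at h
  exact h

theorem momAlong_comm (u v : Config n) : momAlong u * momAlong v = momAlong v * momAlong u := by
  have h : ∀ w : Config n, momAlong w =
      fourierInvEnd n * posAlong ((2 * Real.pi) • w) * fourierEnd n := fun w => by
    rw [(fourierInvEnd_posAlong w).eq, mul_assoc, fourierInvEnd_mul_fourierEnd, mul_one]
  have h2 : ∀ u v : Config n, momAlong u * momAlong v = fourierInvEnd n *
      (posAlong ((2 * Real.pi) • u) * posAlong ((2 * Real.pi) • v)) * fourierEnd n := by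
    intro u v
    rw [h u, h v]
    calc _ = fourierInvEnd n * posAlong ((2 * Real.pi) • u) * (fourierEnd n * fourierInvEnd n) *
          posAlong ((2 * Real.pi) • v) * fourierEnd n := by simp only [mul_assoc]
      _ = _ := by rw [fourierEnd_mul_fourierInvEnd, mul_one]; simp only [mul_assoc]
  rw [h2, h2, posAlong_comm]

/-- The Fourier multiplier `e^{i t p_u p_v}`. -/
def phaseMult (u v : Config n) (t : ℝ) : Module.End ℂ (Schw n) :=
  fourierInvEnd n * phaseMul ((2 * Real.pi) • u) ((2 * Real.pi) • v) t * fourierEnd n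

theorem isFlow_phaseMult (u v : Config n) :
    IsFlow (toL2 n) (momAlong u * momAlong v) (phaseMult u v) :=
  (isFlow_phaseMul _ _).conj fourierInvEnd_mul_fourierEnd fourierEnd_mul_fourierInvEnd
    norm_fourierInvEnd ((fourierInvEnd_posAlong u).mul_right (fourierInvEnd_posAlong v))

theorem phaseMult_momAlong (u v w : Config n) (t : ℝ) :
    SemiconjBy (phaseMult u v t) (momAlong w) (momAlong w) :=
  ((fourierInvEnd_posAlong w).mul_left (phaseMul_posAlong _ _ _ t)).mul_left (fourierEnd_momAlong w)

theorem semiconjBy_smul {R : Type*} [Ring R] [Algebra ℂ R] {a x y : R} (h : SemiconjBy a x y)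
    (c : ℂ) : SemiconjBy a (c • x) (c • y) := by
  rw [SemiconjBy, mul_smul_comm, h.eq, smul_mul_assoc]

/-- Conjugating in turn by the Fourier transform, the phase and the inverse transform takes position
to minus momentum, shifts it, and takes it back. This is done for `2π w` and then rescaled. -/
theorem phaseMult_posAlong (u v w : Config n) (t : ℝ) :
    SemiconjBy (phaseMult u v t) (posAlong w) (posAlong w +
      (t : ℂ) • ((inner ℝ u w : ℂ) • momAlong v + (inner ℝ v w : ℂ) • momAlong u)) := by
  have hpi : (2 * Real.pi : ℂ) ≠ 0 := by exact_mod_cast Real.two_pi_pos.ne'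
  have h1 := fourierEnd_posAlong w
  have h2 := (phaseMul_momAlong ((2 * Real.pi) • u) ((2 * Real.pi) • v) w t).neg_right
  have h3 := ((fourierInvEnd_momAlong w).sub_right (semiconjBy_smul
    ((semiconjBy_smul (fourierInvEnd_posAlong v) (inner ℝ ((2 * Real.pi) • u) w : ℂ)).add_right
    (semiconjBy_smul (fourierInvEnd_posAlong u) (inner ℝ ((2 * Real.pi) • v) w : ℂ))) t)).neg_right
  have h4 := semiconjBy_smul ((h3.mul_left h2).mul_left h1) (2 * Real.pi)⁻¹
  have e1 : (2 * Real.pi : ℂ)⁻¹ • posAlong ((2 * Real.pi) • w) = posAlong w := by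
    rw [posAlong_smul, smul_smul]
    push_cast
    rw [inv_mul_cancel₀ hpi, one_smul]
  have e2 : posAlong w +
      (t : ℂ) • ((inner ℝ u w : ℂ) • momAlong v + (inner ℝ v w : ℂ) • momAlong u) =
      (2 * Real.pi : ℂ)⁻¹ • -(-posAlong ((2 * Real.pi) • w) -
        (t : ℂ) • ((inner ℝ ((2 * Real.pi) • u) w : ℂ) • momAlong v +
          (inner ℝ ((2 * Real.pi) • v) w : ℂ) • momAlong u)) := by
    rw [← e1]
    simp only [real_inner_smul_left]
    push_cast
    match_scalars <;> field_simp
  rw [e1, ← e2] at h4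
  exact h4

end

end Oscillator

namespace Oscillator

noncomputable section

variable {n : ℕ}

section FlowLemmas

variable {D H : Type*} [AddCommGroup D] [Module ℂ D] [NormedAddCommGroup H] [InnerProductSpace ℂ H]
  [NormedSpace ℝ H] {ι : D →ₗ[ℂ] H} {T : Module.End ℂ D} {u : ℝ → Module.End ℂ D}

theorem IsFlow.neg (hu : IsFlow ι T u) : IsFlow ι (-T) (fun t => u (-t)) where
  map_zero := by simp [hu.map_zero]
  map_add s t := by rw [neg_add, hu.map_add]
  hasDerivAt_zero f := by
    have h : HasDerivAt (fun s => ι (u s f)) (Complex.I • ι (T f)) (-0) := by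
      simpa using hu.hasDerivAt_zero f
    have h2 := h.scomp (0 : ℝ) (hasDerivAt_neg (0 : ℝ))
    refine h2.congr_deriv ?_
    simp

/-- An isometry that commutes with a symmetric operator commutes with its flow. -/
theorem IsFlow.commute [IsScalarTower ℝ ℂ H] (hu : IsFlow ι T u) (hT : SymmOn ι T)
    (hι : Function.Injective ι) {V : Module.End ℂ D} (hV : ∀ f, ‖ι (V f)‖ = ‖ι f‖)
    (hVT : Commute V T) (t : ℝ) : Commute V (u t) := by
  ext f
  refine hT.trajectory_eq hι (y := fun t => V (u t f)) (z := fun t => u t (V f)) isOpen_univ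
    isPreconnected_univ (fun t _ => ?_) (fun t _ => hu.hasDerivAt t (V f)) (Set.mem_univ 0)
    (Set.mem_univ t) (by simp [hu.map_zero])
  have h := hu.hasDerivAt t f
  rw [← map_smul] at h
  have h2 := hasDerivAt_map_isometry hV h
  rw [map_smul, map_smul, ← Module.End.mul_apply, hVT.eq] at h2
  exact h2

end FlowLemmas

/-! ### Quadratic generators: oscillator pairs, shears and rotations. -/

section Quadratic

variable {u v : Config n}

theorem symmOn_posAlong_mul (u v : Config n) : SymmOn (toL2 n) (posAlong u * posAlong v) :=
  (symmOn_posAlong u).mul (symmOn_posAlong v) (posAlong_comm u v)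

theorem symmOn_momAlong_mul (u v : Config n) : SymmOn (toL2 n) (momAlong u * momAlong v) :=
  (symmOn_momAlong u).mul (symmOn_momAlong v) (momAlong_comm u v)

theorem posAlong_momAlong_comm (h : inner ℝ u v = 0) :
    posAlong u * momAlong v = momAlong v * posAlong u := by
  rw [momAlong_posAlong, h]
  simp

theorem symmOn_posAlong_mul_momAlong (h : inner ℝ u v = 0) :
    SymmOn (toL2 n) (posAlong u * momAlong v) :=
  (symmOn_posAlong u).mul (symmOn_momAlong v) (posAlong_momAlong_comm h)

/-- Here `E = x_u x_v` and `F = p_u p_v`. Orthogonality makes the momentum phase send `x_u` to `x_u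
+ α r p_v` and `x_v` to `x_v + α r p_u`, and multiplying these out gives `K`. General `r` is kept
because `opH` needs `r = 2`. -/
theorem isLocalFlow_oscillator {r : ℝ} (hr : 0 < r) (huv : inner ℝ u v = 0)
    (hu : inner ℝ u u = r) (hv : inner ℝ v v = r) :
    IsLocalFlow (toL2 n) ((1 / 2 : ℂ) • (posAlong u * posAlong v + momAlong u * momAlong v))
      (2 * Real.pi / r) (fun t =>
        phaseMult u v (Real.tan (r * t / 4) / r) * phaseMul u v (Real.sin (r * t / 2) / r) *
          phaseMult u v (Real.tan (r * t / 4) / r)) := by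
  have hvu : inner ℝ v u = 0 := by rw [real_inner_comm, huv]
  have hXu : ∀ α, SemiconjBy (phaseMult u v α) (posAlong u)
      (posAlong u + ((α * r : ℝ) : ℂ) • momAlong v) := fun α => by
    have h := phaseMult_posAlong u v u α
    rw [hu, hvu] at h
    simp only [Complex.ofReal_zero, zero_smul, add_zero, smul_smul,
      ← Complex.ofReal_mul] at h
    exact h
  have hXv : ∀ α, SemiconjBy (phaseMult u v α) (posAlong v)
      (posAlong v + ((α * r : ℝ) : ℂ) • momAlong u) := fun α => by
    have h := phaseMult_posAlong u v v α
    rw [hv, huv] at h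
    simp only [Complex.ofReal_zero, zero_smul, zero_add, smul_smul,
      ← Complex.ofReal_mul] at h
    exact h
  have hPu : ∀ β, SemiconjBy (phaseMul u v β) (momAlong u)
      (momAlong u - ((β * r : ℝ) : ℂ) • posAlong v) := fun β => by
    have h := phaseMul_momAlong u v u β
    rw [hu, hvu] at h
    simp only [Complex.ofReal_zero, zero_smul, add_zero, smul_smul,
      ← Complex.ofReal_mul] at h
    exact h
  have hPv : ∀ β, SemiconjBy (phaseMul u v β) (momAlong v)
      (momAlong v - ((β * r : ℝ) : ℂ) • posAlong u) := fun β => by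
    have h := phaseMul_momAlong u v v β
    rw [hv, huv] at h
    simp only [Complex.ofReal_zero, zero_smul, zero_add, smul_smul,
      ← Complex.ofReal_mul] at h
    exact h
  refine isLocalFlow_three_factor (K := (r : ℂ) • (posAlong u * momAlong u + momAlong v * posAlong v))
    (isFlow_phaseMult u v) (isFlow_phaseMul u v) (symmOn_momAlong_mul u v)
    (symmOn_posAlong_mul u v) hr ?_ ?_ ?_ ?_
  · intro α
    exact (phaseMult_momAlong u v u α).mul_right (phaseMult_momAlong u v v α)
  · intro α
    refine Eq.trans (semiconjBy_smul (((hXu α).mul_right (phaseMult_momAlong u v u α)).add_right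
      ((phaseMult_momAlong u v v α).mul_right (hXv α))) (r : ℂ)).eq ?_
    congr 1
    simp only [add_mul, mul_add, smul_mul_assoc, mul_smul_comm, momAlong_comm v u]
    push_cast
    module
  · intro α
    refine Eq.trans ((hXu α).mul_right (hXv α)).eq ?_
    congr 1
    simp only [add_mul, mul_add, smul_mul_assoc, mul_smul_comm, momAlong_comm v u]
    push_cast
    module
  -- Here `K` appears with its products in the opposite order; the commutators cancel because `u`
  -- and `v` have the same squared length.
  · intro β
    refine Eq.trans ((hPu β).mul_right (hPv β)).eq ?_
    congr 1
    simp only [sub_mul, mul_sub, smul_mul_assoc, mul_smul_comm, posAlong_comm v u,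
      momAlong_posAlong, hu, hv]
    push_cast
    module

/-- For a unit vector `k`, the quarter period of the oscillator in direction `k`. -/
def quarterTurn (k : Config n) : Module.End ℂ (Schw n) :=
  phaseMult k k (1 / 2) * phaseMul k k (1 / 2) * phaseMult k k (1 / 2)

/-- The inverse of `quarterTurn`. -/
def quarterTurnInv (k : Config n) : Module.End ℂ (Schw n) :=
  phaseMult k k (-(1 / 2)) * phaseMul k k (-(1 / 2)) * phaseMult k k (-(1 / 2))

theorem quarterTurn_mul_inv (k : Config n) : quarterTurn k * quarterTurnInv k = 1 := by
  have h1 := (isFlow_phaseMult k k).mul_neg (1 / 2)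
  have h2 := (isFlow_phaseMul k k).mul_neg (1 / 2)
  calc _ = phaseMult k k (1 / 2) * (phaseMul k k (1 / 2) *
        (phaseMult k k (1 / 2) * phaseMult k k (-(1 / 2))) * phaseMul k k (-(1 / 2))) *
        phaseMult k k (-(1 / 2)) := by simp only [quarterTurn, quarterTurnInv, mul_assoc]
    _ = 1 := by rw [h1, mul_one, h2, mul_one, h1]

theorem quarterTurnInv_mul (k : Config n) : quarterTurnInv k * quarterTurn k = 1 := by
  have h1 := (isFlow_phaseMult k k).neg_mul (1 / 2)
  have h2 := (isFlow_phaseMul k k).neg_mul (1 / 2)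
  calc _ = phaseMult k k (-(1 / 2)) * (phaseMul k k (-(1 / 2)) *
        (phaseMult k k (-(1 / 2)) * phaseMult k k (1 / 2)) * phaseMul k k (1 / 2)) *
        phaseMult k k (1 / 2) := by simp only [quarterTurn, quarterTurnInv, mul_assoc]
    _ = 1 := by rw [h1, mul_one, h2, mul_one, h1]

theorem norm_phaseMult (u v : Config n) (t : ℝ) (f : Schw n) :
    ‖toL2 n (phaseMult u v t f)‖ = ‖toL2 n f‖ :=
  (isFlow_phaseMult u v).norm_map (symmOn_momAlong_mul u v) t f

theorem norm_phaseMul (u v : Config n) (t : ℝ) (f : Schw n) :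
    ‖toL2 n (phaseMul u v t f)‖ = ‖toL2 n f‖ :=
  (isFlow_phaseMul u v).norm_map (symmOn_posAlong_mul u v) t f

theorem norm_quarterTurn (k : Config n) (f : Schw n) :
    ‖toL2 n (quarterTurn k f)‖ = ‖toL2 n f‖ := by
  simp [quarterTurn, norm_phaseMult, norm_phaseMul]

variable {k : Config n}

/-- At parameter `1/2` a squared phase shifts by exactly one, so the factors act as `x ↦ x + p ↦ p ↦
p`. The quarter turn thus plays the role of a partial Fourier transform in direction `k`. -/
theorem quarterTurn_posAlong (hk : inner ℝ k k = 1) :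
    SemiconjBy (quarterTurn k) (posAlong k) (momAlong k) := by
  have h1 := phaseMult_posAlong k k k (1 / 2)
  have h2 := (phaseMul_posAlong k k k (1 / 2)).add_right (phaseMul_momAlong k k k (1 / 2))
  rw [hk] at h1 h2
  have e1 : posAlong k + ((1 / 2 : ℝ) : ℂ) •
      (((1 : ℝ) : ℂ) • momAlong k + ((1 : ℝ) : ℂ) • momAlong k) = posAlong k + momAlong k := by
    push_cast
    module
  have e2 : posAlong k + (momAlong k - ((1 / 2 : ℝ) : ℂ) •
      (((1 : ℝ) : ℂ) • posAlong k + ((1 : ℝ) : ℂ) • posAlong k)) = momAlong k := by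
    push_cast
    module
  rw [e1] at h1
  rw [e2] at h2
  exact ((phaseMult_momAlong k k k (1 / 2)).mul_left h2).mul_left h1

theorem quarterTurn_momAlong (hk : inner ℝ k k = 1) :
    SemiconjBy (quarterTurn k) (momAlong k) (-posAlong k) := by
  have h1 := (phaseMult_momAlong k k k (1 / 2)).sub_right (phaseMult_posAlong k k k (1 / 2))
  have h2 := phaseMul_momAlong k k k (1 / 2)
  rw [hk] at h1 h2
  have e1 : momAlong k - (posAlong k + ((1 / 2 : ℝ) : ℂ) •
      (((1 : ℝ) : ℂ) • momAlong k + ((1 : ℝ) : ℂ) • momAlong k)) = -posAlong k := by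
    push_cast
    module
  have e2 : momAlong k - ((1 / 2 : ℝ) : ℂ) •
      (((1 : ℝ) : ℂ) • posAlong k + ((1 : ℝ) : ℂ) • posAlong k) = momAlong k - posAlong k := by
    push_cast
    module
  rw [e1] at h1
  rw [e2] at h2
  exact (h1.mul_left h2).mul_left (phaseMult_momAlong k k k (1 / 2))

theorem quarterTurn_posAlong_of_perp {w : Config n} (hw : inner ℝ k w = 0) :
    SemiconjBy (quarterTurn k) (posAlong w) (posAlong w) := by
  have h1 := phaseMult_posAlong k k w (1 / 2)
  simp only [hw, Complex.ofReal_zero, zero_smul, add_zero, smul_zero] at h1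
  exact (h1.mul_left (phaseMul_posAlong k k w (1 / 2))).mul_left h1

theorem quarterTurn_momAlong_of_perp {w : Config n} (hw : inner ℝ k w = 0) :
    SemiconjBy (quarterTurn k) (momAlong w) (momAlong w) := by
  have h1 := phaseMul_momAlong k k w (1 / 2)
  simp only [hw, Complex.ofReal_zero, zero_smul, add_zero, smul_zero, sub_zero] at h1
  have h2 := phaseMult_momAlong k k w (1 / 2)
  exact (h2.mul_left h1).mul_left h2

theorem semiconjBy_quarterTurnInv {x y : Module.End ℂ (Schw n)}
    (h : SemiconjBy (quarterTurn k) x y) : SemiconjBy (quarterTurnInv k) y x :=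
  semiconjBy_symm h (quarterTurn_mul_inv k) (quarterTurnInv_mul k)

/-- For orthogonal `u` and `k`, `k` a unit vector, this is `f ↦ f (x + t ⟪u, x⟫ k)`, written as a
conjugate of multiplication by a phase. -/
def shear (u k : Config n) (t : ℝ) : Module.End ℂ (Schw n) :=
  quarterTurn k * phaseMul u k t * quarterTurnInv k

theorem isFlow_shear (hk : inner ℝ k k = 1) (hu : inner ℝ k u = 0) :
    IsFlow (toL2 n) (posAlong u * momAlong k) (shear u k) :=
  (isFlow_phaseMul u k).conj (quarterTurn_mul_inv k) (quarterTurnInv_mul k) (norm_quarterTurn k)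
    ((quarterTurn_posAlong_of_perp hu).mul_right (quarterTurn_posAlong hk)).eq

theorem shear_momAlong (hk : inner ℝ k k = 1) (t : ℝ) :
    SemiconjBy (shear u k t) (momAlong k) (momAlong k) :=
  ((quarterTurn_posAlong hk).mul_left (phaseMul_posAlong u k k t)).mul_left
    (semiconjBy_quarterTurnInv (quarterTurn_posAlong hk))

theorem shear_posAlong (hu : inner ℝ k u = 0) (t : ℝ) :
    SemiconjBy (shear u k t) (posAlong u) (posAlong u) :=
  ((quarterTurn_posAlong_of_perp hu).mul_left (phaseMul_posAlong u k u t)).mul_left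
    (semiconjBy_quarterTurnInv (quarterTurn_posAlong_of_perp hu))

theorem shear_posAlong_self (hk : inner ℝ k k = 1) (hu : inner ℝ k u = 0) (t : ℝ) :
    SemiconjBy (shear u k t) (posAlong k) (posAlong k + (t : ℂ) • posAlong u) := by
  have h1 := phaseMul_momAlong u k k t
  rw [real_inner_comm, hu, hk] at h1
  simp only [Complex.ofReal_zero, zero_smul, zero_add, Complex.ofReal_one, one_smul] at h1
  have h2 := (quarterTurn_momAlong hk).sub_right
    (semiconjBy_smul (quarterTurn_posAlong_of_perp hu) (t : ℂ))
  have h3 := ((h2.mul_left h1).mul_left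
    (semiconjBy_quarterTurnInv (quarterTurn_momAlong hk))).neg_right
  rwa [neg_neg, show -(-posAlong k - (t : ℂ) • posAlong u) = posAlong k + (t : ℂ) • posAlong u by
    abel] at h3

theorem shear_momAlong_self (hk : inner ℝ k k = 1) (hu : inner ℝ k u = 0)
    (huu : inner ℝ u u = 1) (t : ℝ) :
    SemiconjBy (shear u k t) (momAlong u) (momAlong u - (t : ℂ) • momAlong k) := by
  have h1 := phaseMul_momAlong u k u t
  rw [hu, huu] at h1
  simp only [Complex.ofReal_zero, zero_smul, add_zero, Complex.ofReal_one, one_smul] at h1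
  have h2 := (quarterTurn_momAlong_of_perp hu).sub_right
    (semiconjBy_smul (quarterTurn_posAlong hk) (t : ℂ))
  exact (h2.mul_left h1).mul_left (semiconjBy_quarterTurnInv (quarterTurn_momAlong_of_perp hu))

/-- Same scheme with `E = p_j x_k`, `F = -x_j p_k` and `r = 1`. Both flows are shears; the sign of
`F` reverses time in the outer one. Reordering `K` costs nothing, as its two commutators cancel in
the difference. -/
theorem isLocalFlow_rotation {j : Config n} (hj : inner ℝ j j = 1) (hk : inner ℝ k k = 1)
    (hjk : inner ℝ j k = 0) :
    IsLocalFlow (toL2 n) ((1 / 2 : ℂ) • (momAlong j * posAlong k + -(posAlong j * momAlong k)))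
      (2 * Real.pi / 1) (fun t =>
        shear j k (-(Real.tan (1 * t / 4) / 1)) * shear k j (Real.sin (1 * t / 2) / 1) *
          shear j k (-(Real.tan (1 * t / 4) / 1))) := by
  have hkj : inner ℝ k j = 0 := by rw [real_inner_comm, hjk]
  have hB := isFlow_shear hj hjk
  have hE := symmOn_posAlong_mul_momAlong hkj
  rw [posAlong_momAlong_comm hkj] at hB hE
  have hXk : ∀ α : ℝ, SemiconjBy (shear j k (-α)) (posAlong k)
      (posAlong k - (α : ℂ) • posAlong j) := fun α => by
    have h := shear_posAlong_self hk hkj (-α)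
    rwa [Complex.ofReal_neg, neg_smul, ← sub_eq_add_neg] at h
  have hPj : ∀ α : ℝ, SemiconjBy (shear j k (-α)) (momAlong j)
      (momAlong j + (α : ℂ) • momAlong k) := fun α => by
    have h := shear_momAlong_self hk hkj hj (-α)
    rwa [Complex.ofReal_neg, neg_smul, sub_neg_eq_add] at h
  refine isLocalFlow_three_factor (A := fun t => shear j k (-t))
    (K := momAlong k * posAlong k - momAlong j * posAlong j)
    (isFlow_shear hk hkj).neg hB (symmOn_posAlong_mul_momAlong hjk).neg hE one_pos ?_ ?_ ?_ ?_
  · intro α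
    exact ((shear_posAlong hkj (-α)).mul_right (shear_momAlong hk (-α))).neg_right
  · intro α
    refine Eq.trans (((shear_momAlong hk (-α)).mul_right (hXk α)).sub_right
      ((hPj α).mul_right (shear_posAlong hkj (-α)))).eq ?_
    congr 1
    simp only [add_mul, mul_sub, smul_mul_assoc, mul_smul_comm, posAlong_momAlong_comm hjk]
    push_cast
    module
  · intro α
    refine Eq.trans ((hPj α).mul_right (hXk α)).eq ?_
    congr 1
    simp only [add_mul, mul_sub, smul_mul_assoc, mul_smul_comm, posAlong_momAlong_comm hjk]
    push_cast
    module
  · intro β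
    refine Eq.trans ((shear_posAlong_self hj hjk β).mul_right
      (shear_momAlong_self hj hjk hk β)).neg_right.eq ?_
    congr 1
    simp only [add_mul, mul_sub, smul_mul_assoc, mul_smul_comm, momAlong_posAlong, hj, hk, hkj]
    push_cast
    module

end Quadratic

/-! ### The exponentials of the operators in the theorem. -/

/-- The standard basis vectors of `ℝⁿ`. -/
def unitVec (j : Fin n) : Config n := EuclideanSpace.single j (1 : ℝ)

theorem inner_unitVec_self (j : Fin n) : inner ℝ (unitVec j) (unitVec j) = 1 := by
  simp [unitVec]

theorem inner_unitVec_of_ne {j k : Fin n} (h : j ≠ k) :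
    inner ℝ (unitVec j) (unitVec k) = 0 := by
  rw [unitVec, unitVec, EuclideanSpace.inner_single_left]
  simp [h]

theorem posOp_toLinearMap (j : Fin n) : (posOp j).toLinearMap = posAlong (unitVec j) := by
  ext f x
  rw [posAlong_apply, unitVec, EuclideanSpace.inner_single_left]
  simp [posOp_apply]

theorem momOp_toLinearMap (j : Fin n) : (momOp j).toLinearMap = momAlong (unitVec j) := rfl

theorem comp_toLinearMap (S T : Schw n →L[ℂ] Schw n) :
    (S ∘L T).toLinearMap = S.toLinearMap * T.toLinearMap := rfl

theorem expI_posOp_posOp (j k : Fin n) : HasExp (posOp j ∘L posOp k) ∧ ∀ t f,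
    expI t (posOp j ∘L posOp k) (toL2 n f) = toL2 n (phaseMul (unitVec j) (unitVec k) t f) := by
  apply IsFlow.expI_apply <;> rw [comp_toLinearMap, posOp_toLinearMap, posOp_toLinearMap]
  exacts [isFlow_phaseMul _ _, symmOn_posAlong_mul _ _]

theorem expI_momOp_momOp (j k : Fin n) : HasExp (momOp j ∘L momOp k) ∧ ∀ t f,
    expI t (momOp j ∘L momOp k) (toL2 n f) = toL2 n (phaseMult (unitVec j) (unitVec k) t f) := by
  apply IsFlow.expI_apply <;> rw [comp_toLinearMap, momOp_toLinearMap, momOp_toLinearMap]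
  exacts [isFlow_phaseMult _ _, symmOn_momAlong_mul _ _]

theorem expI_posOp_momOp {j k : Fin n} (h : j ≠ k) : HasExp (posOp j ∘L momOp k) ∧ ∀ t f,
    expI t (posOp j ∘L momOp k) (toL2 n f) = toL2 n (shear (unitVec j) (unitVec k) t f) := by
  apply IsFlow.expI_apply <;> rw [comp_toLinearMap, posOp_toLinearMap, momOp_toLinearMap]
  exacts [isFlow_shear (inner_unitVec_self k) (inner_unitVec_of_ne h.symm),
    symmOn_posAlong_mul_momAlong (inner_unitVec_of_ne h)]

theorem expI_momOp_posOp {j k : Fin n} (h : j ≠ k) : HasExp (momOp j ∘L posOp k) ∧ ∀ t f,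
    expI t (momOp j ∘L posOp k) (toL2 n f) = toL2 n (shear (unitVec k) (unitVec j) t f) := by
  have hcomm : momOp j ∘L posOp k = posOp k ∘L momOp j := by
    apply ContinuousLinearMap.coe_injective
    rw [comp_toLinearMap, comp_toLinearMap, posOp_toLinearMap, momOp_toLinearMap,
      posAlong_momAlong_comm (inner_unitVec_of_ne h.symm)]
  rw [hcomm]
  exact expI_posOp_momOp h.symm

theorem expI_opS {j k : Fin n} (h : j ≠ k) : HasExp (opS j k) ∧
    ∀ t ∈ Set.Icc (-(Real.pi / 2)) (Real.pi / 2), expI t (opS j k) =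
      expI (Real.tan (t / 4)) (momOp j ∘L momOp k) ∘L
      expI (Real.sin (t / 2)) (posOp j ∘L posOp k) ∘L
      expI (Real.tan (t / 4)) (momOp j ∘L momOp k) := by
  have hT : (opS j k).toLinearMap = (1 / 2 : ℂ) • (posAlong (unitVec j) * posAlong (unitVec k) +
      momAlong (unitVec j) * momAlong (unitVec k)) := by
    rw [← posOp_toLinearMap, ← posOp_toLinearMap, ← momOp_toLinearMap, ← momOp_toLinearMap]
    rfl
  have hflow := isLocalFlow_oscillator one_pos (inner_unitVec_of_ne h) (inner_unitVec_self j)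
    (inner_unitVec_self k)
  have hsymm := ((symmOn_posAlong_mul (unitVec j) (unitVec k)).add
    (symmOn_momAlong_mul (unitVec j) (unitVec k))).smul (1 / 2)
  rw [Complex.ofReal_div, Complex.ofReal_one, Complex.ofReal_ofNat, ← hT] at hsymm
  rw [← hT] at hflow
  obtain ⟨hexp, happly⟩ := hflow.expI_apply (by have := Real.pi_pos; positivity) hsymm
  refine ⟨hexp, fun t ht => hilb_ext fun f => ?_⟩
  rw [happly t ⟨by linarith [ht.1, Real.pi_pos], by linarith [ht.2, Real.pi_pos]⟩]
  simp [(expI_posOp_posOp j k).2, (expI_momOp_momOp j k).2]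

theorem expI_opA {j k : Fin n} (h : j ≠ k) : HasExp (opA j k) ∧
    ∀ t ∈ Set.Icc (-(Real.pi / 2)) (Real.pi / 2), expI t (opA j k) =
      expI (-Real.tan (t / 4)) (posOp j ∘L momOp k) ∘L
      expI (Real.sin (t / 2)) (momOp j ∘L posOp k) ∘L
      expI (-Real.tan (t / 4)) (posOp j ∘L momOp k) := by
  have hT : (opA j k).toLinearMap = (1 / 2 : ℂ) • (momAlong (unitVec j) * posAlong (unitVec k) +
      -(posAlong (unitVec j) * momAlong (unitVec k))) := by
    rw [← posOp_toLinearMap, ← posOp_toLinearMap, ← momOp_toLinearMap, ← momOp_toLinearMap,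
      ← sub_eq_add_neg]
    rfl
  have hflow := isLocalFlow_rotation (inner_unitVec_self j) (inner_unitVec_self k)
    (inner_unitVec_of_ne h)
  have hE := symmOn_posAlong_mul_momAlong (inner_unitVec_of_ne h.symm)
  rw [posAlong_momAlong_comm (inner_unitVec_of_ne h.symm)] at hE
  have hsymm := (hE.add (symmOn_posAlong_mul_momAlong (inner_unitVec_of_ne h)).neg).smul (1 / 2)
  rw [Complex.ofReal_div, Complex.ofReal_one, Complex.ofReal_ofNat, ← hT] at hsymm
  rw [← hT] at hflow
  obtain ⟨hexp, happly⟩ := hflow.expI_apply (by have := Real.pi_pos; positivity) hsymm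
  refine ⟨hexp, fun t ht => hilb_ext fun f => ?_⟩
  rw [happly t ⟨by linarith [ht.1, Real.pi_pos], by linarith [ht.2, Real.pi_pos]⟩]
  simp [(expI_posOp_momOp h).2, (expI_momOp_posOp h).2]

theorem phaseMul_sum_diff (u v : Config n) (t : ℝ) :
    phaseMul (u + (-1 : ℝ) • v) (u + v) t = phaseMul u u t * phaseMul v v (-t) := by
  ext f x
  simp only [phaseMul_apply, Module.End.mul_apply, phase, ← mul_assoc, ← Complex.exp_add]
  congr 2
  simp only [inner_add_left, real_inner_smul_left]
  push_cast
  ring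

theorem phaseMult_sum_diff (u v : Config n) (t : ℝ) :
    phaseMult (u + (-1 : ℝ) • v) (u + v) t = phaseMult u u t * phaseMult v v (-t) := by
  have h : phaseMul ((2 * Real.pi) • (u + (-1 : ℝ) • v)) ((2 * Real.pi) • (u + v)) t =
      phaseMul ((2 * Real.pi) • u) ((2 * Real.pi) • u) t *
        (fourierEnd n * fourierInvEnd n) *
        phaseMul ((2 * Real.pi) • v) ((2 * Real.pi) • v) (-t) := by
    rw [fourierEnd_mul_fourierInvEnd, mul_one, ← phaseMul_sum_diff, smul_add, smul_add,
      smul_comm (2 * Real.pi) (-1 : ℝ)]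
  simp only [phaseMult, h, mul_assoc]

/-- The position phase along `u` commutes with `p_v` by orthogonality, hence with the flow of its
square. -/
theorem commute_phaseMul_phaseMult {u v : Config n} (h : inner ℝ u v = 0) (s t : ℝ) :
    Commute (phaseMul u u s) (phaseMult v v t) := by
  have h1 := phaseMul_momAlong u u v s
  simp only [h, Complex.ofReal_zero, zero_smul, add_zero, smul_zero, sub_zero] at h1
  exact (isFlow_phaseMult v v).commute (symmOn_momAlong_mul v v) toL2_injective
    (norm_phaseMul u u s) (h1.mul_right h1) t

theorem commute_phaseMult_phaseMult (u v : Config n) (s t : ℝ) :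
    Commute (phaseMult u u s) (phaseMult v v t) :=
  (isFlow_phaseMult v v).commute (symmOn_momAlong_mul v v) toL2_injective
    (norm_phaseMult u u s) ((phaseMult_momAlong u u v s).mul_right (phaseMult_momAlong u u v s)) t

/-- Along `e - e'` and `e + e'` the generator is an oscillator pair with `r = 2`, whence the
parameters `tan(t/2)/2` and `sin(t)/2` and the window `|t| < π`. -/
theorem expI_opH {i i' : Fin n} (h : i ≠ i') : HasExp (opH i i') ∧
    ∀ t ∈ Set.Icc (-(Real.pi / 2)) (Real.pi / 2), expI t (opH i i') =
      expI (Real.tan (t / 2) / 2) (momOp i ∘L momOp i) ∘L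
      expI (Real.sin t / 2) (posOp i ∘L posOp i) ∘L
      expI (Real.tan (t / 2) / 2) (momOp i ∘L momOp i) ∘L
      expI (-(Real.tan (t / 2) / 2)) (momOp i' ∘L momOp i') ∘L
      expI (-(Real.sin t / 2)) (posOp i' ∘L posOp i') ∘L
      expI (-(Real.tan (t / 2) / 2)) (momOp i' ∘L momOp i') := by
  set e := unitVec i with he
  set e' := unitVec i' with he'
  have hee : inner ℝ e e = 1 := inner_unitVec_self i
  have hee' : inner ℝ e' e' = 1 := inner_unitVec_self i'
  have h0 : inner ℝ e e' = 0 := inner_unitVec_of_ne h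
  have h0' : inner ℝ e' e = 0 := inner_unitVec_of_ne h.symm
  have hT : (opH i i').toLinearMap = (1 / 2 : ℂ) •
      (posAlong (e + (-1 : ℝ) • e') * posAlong (e + e') +
        momAlong (e + (-1 : ℝ) • e') * momAlong (e + e')) := by
    have h1 : (opH i i').toLinearMap = (1 / 2 : ℂ) • (posAlong e * posAlong e +
        momAlong e * momAlong e - posAlong e' * posAlong e' - momAlong e' * momAlong e') := by
      rw [he, he', ← posOp_toLinearMap, ← posOp_toLinearMap, ← momOp_toLinearMap,
        ← momOp_toLinearMap]
      rfl
    rw [h1]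
    simp only [posAlong_add, posAlong_smul, momAlong_add, momAlong_smul, add_mul, mul_add,
      smul_mul_assoc, posAlong_comm e' e, momAlong_comm e' e]
    push_cast
    module
  have hflow := isLocalFlow_oscillator (u := e + (-1 : ℝ) • e') (v := e + e') two_pos
    (by simp only [inner_add_left, inner_add_right, real_inner_smul_left]; linarith)
    (by
      simp only [inner_add_left, inner_add_right, real_inner_smul_left, real_inner_smul_right]
      linarith)
    (by simp only [inner_add_left, inner_add_right]; linarith)
  have hsymm := ((symmOn_posAlong_mul (e + (-1 : ℝ) • e') (e + e')).add
    (symmOn_momAlong_mul (e + (-1 : ℝ) • e') (e + e'))).smul (1 / 2)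
  rw [Complex.ofReal_div, Complex.ofReal_one, Complex.ofReal_ofNat, ← hT] at hsymm
  rw [← hT] at hflow
  obtain ⟨hexp, happly⟩ := hflow.expI_apply (by have := Real.pi_pos; positivity) hsymm
  refine ⟨hexp, fun t ht => hilb_ext fun f => ?_⟩
  rw [happly t ⟨by linarith [ht.1, Real.pi_pos], by linarith [ht.2, Real.pi_pos]⟩]
  simp only [ContinuousLinearMap.comp_apply, (expI_posOp_posOp i i).2, (expI_momOp_momOp i i).2,
    (expI_posOp_posOp i' i').2, (expI_momOp_momOp i' i').2, ← he, ← he']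
  rw [show 2 * t / 4 = t / 2 by ring, show 2 * t / 2 = t by ring]
  generalize Real.tan (t / 2) / 2 = α
  generalize Real.sin t / 2 = β
  -- Each factor splits into one per mode, with opposite parameters; commuting the `e'` factors to
  -- the right separates the modes.
  have key : phaseMult (e + (-1 : ℝ) • e') (e + e') α * phaseMul (e + (-1 : ℝ) • e') (e + e') β *
      phaseMult (e + (-1 : ℝ) • e') (e + e') α =
      phaseMult e e α * (phaseMul e e β * (phaseMult e e α * (phaseMult e' e' (-α) *
        (phaseMul e' e' (-β) * phaseMult e' e' (-α))))) := by
    rw [phaseMul_sum_diff, phaseMult_sum_diff]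
    have c1 := (commute_phaseMul_phaseMult h0 β (-α)).eq
    have c2 := (commute_phaseMul_phaseMult h0' (-β) α).eq
    have c3 := (commute_phaseMult_phaseMult e e' α (-α)).eq
    calc _ = phaseMult e e α * (phaseMult e' e' (-α) * phaseMul e e β) *
          (phaseMul e' e' (-β) * phaseMult e e α) * phaseMult e' e' (-α) := by
          simp only [mul_assoc]
      _ = phaseMult e e α * phaseMul e e β * (phaseMult e' e' (-α) * phaseMult e e α) *
          phaseMul e' e' (-β) * phaseMult e' e' (-α) := by
          rw [← c1, c2]
          simp only [mul_assoc]
      _ = _ := by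
          rw [← c3]
          simp only [mul_assoc]
  rw [key]
  rfl

end

end Oscillator

open Oscillator in
theorem lemma1 (n : ℕ) (hn : 2 ≤ n) (ς ϑ φ : ℝ)
    (hς : ς ∈ Set.Icc (-(Real.pi / 2)) (Real.pi / 2))
    (hϑ : ϑ ∈ Set.Icc (-(Real.pi / 2)) (Real.pi / 2))
    (hφ : φ ∈ Set.Icc (-(Real.pi / 2)) (Real.pi / 2)) :
    -- all the exponentials below are well defined
    (∀ j : Fin n, HasExp (posOp j ∘L posOp j) ∧ HasExp (momOp j ∘L momOp j)) ∧
    (∀ j k : Fin n, j < k →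
      HasExp (posOp j ∘L posOp k) ∧ HasExp (momOp j ∘L momOp k) ∧
      HasExp (posOp j ∘L momOp k) ∧ HasExp (momOp j ∘L posOp k) ∧
      HasExp (opS j k) ∧ HasExp (opA j k)) ∧
    (∀ i i' : Fin n, (i' : ℕ) = i + 1 → HasExp (opH i i')) ∧
    -- the three factorizations
    (∀ i i' : Fin n, (i' : ℕ) = i + 1 →
      expI ς (opH i i') =
        expI (Real.tan (ς / 2) / 2) (momOp i ∘L momOp i) ∘L
        expI (Real.sin ς / 2) (posOp i ∘L posOp i) ∘L
        expI (Real.tan (ς / 2) / 2) (momOp i ∘L momOp i) ∘L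
        expI (-(Real.tan (ς / 2) / 2)) (momOp i' ∘L momOp i') ∘L
        expI (-(Real.sin ς / 2)) (posOp i' ∘L posOp i') ∘L
        expI (-(Real.tan (ς / 2) / 2)) (momOp i' ∘L momOp i')) ∧
    (∀ j k : Fin n, j < k →
      expI ϑ (opS j k) =
        expI (Real.tan (ϑ / 4)) (momOp j ∘L momOp k) ∘L
        expI (Real.sin (ϑ / 2)) (posOp j ∘L posOp k) ∘L
        expI (Real.tan (ϑ / 4)) (momOp j ∘L momOp k)) ∧
    (∀ j k : Fin n, j < k →
      expI φ (opA j k) =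
        expI (-Real.tan (φ / 4)) (posOp j ∘L momOp k) ∘L
        expI (Real.sin (φ / 2)) (momOp j ∘L posOp k) ∘L
        expI (-Real.tan (φ / 4)) (posOp j ∘L momOp k)) := by
  have hne : ∀ {i i' : Fin n}, (i' : ℕ) = i + 1 → i ≠ i' := by
    rintro i i' h rfl
    omega
  exact ⟨fun j => ⟨(expI_posOp_posOp j j).1, (expI_momOp_momOp j j).1⟩,
    fun j k h => ⟨(expI_posOp_posOp j k).1, (expI_momOp_momOp j k).1, (expI_posOp_momOp h.ne).1,
      (expI_momOp_posOp h.ne).1, (expI_opS h.ne).1, (expI_opA h.ne).1⟩,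
    fun i i' h => (expI_opH (hne h)).1, fun i i' h => (expI_opH (hne h)).2 ς hς,
    fun j k h => (expI_opS h.ne).2 ϑ hϑ, fun j k h => (expI_opA h.ne).2 φ hφ⟩
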